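/- Let $X=\{F=0\}\subset\mathbb{P}^4$ be a smooth complex cubic threefold. A line $\ell\subset X$ is of the second type if there is a unique plane $P\supset\ell$ such that $P\cap X=2\ell\cup\ell'$ (as divisors on $P$) for some line $\ell'$, and it is a triple line if there is a plane $P\supset\ell$ with $P\cap X=3\ell$. Let $M(X)$ be the curve of lines of the second type on the Fano surface of lines of $X$, given in the affine chart $p_{i,j}=1$ of the Grassmannian of lines as follows: the lines of the chart are spanned by $v_0=e_i+\sum_k a_{0,k}e_k$ and $v_1=e_j+\sum_k a_{1,k}e_k$, where $k$ runs over the three indices different from $i,j$; the equations of $M(X)$ in the six coordinates $a_{u,k}$ are the vanishing of the four coefficients of the binary cubic $F(t_0v_0+t_1v_1)$, together with the vanishing of the determinant of the $3\times 3$ matrix of the coefficients of the three binary quadratic forms $\frac{\partial F}{\partial x_k}(t_0v_0+t_1v_1)$, $k\ne i,j$. Then: 1. the closed points of the scheme $M(X)$ are exactly the lines of the second type on $X$; 2. the singular points of $M(X)$ (the closed points at which its local ring is not regular) are exactly the triple lines on $X$; 3. $M(X)$ is reduced. -/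

import Mathlib

noncomputable section

namespace CubicThreefold

/-- The hypersurface `F = 0` in `ℙ⁴` (for `F` homogeneous) is smooth: the partial derivatives of `F`
have no common zero on it. -/
def IsSmooth (F : MvPolynomial (Fin 5) ℂ) : Prop :=
  ∀ x : Fin 5 → ℂ, x ≠ 0 → MvPolynomial.eval x F = 0 →
    ∃ i, MvPolynomial.eval x (MvPolynomial.pderiv i F) ≠ 0

/-! Lines and planes of `ℙ⁴` are the linear subspaces of `ℂ⁵` of dimension `2` and `3`. -/

/-- `P` is a plane, `L` and `L'` are lines contained in `P`, and the plane cubic `P ∩ X` is the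
divisor `2L + L'` on `P`: there are linear forms `l` and `m` whose restrictions to `P` are
equations of `L` and of `L'`, and `F` restricted to `P` is `l² m`. -/
def PlaneSection (F : MvPolynomial (Fin 5) ℂ) (P L L' : Submodule ℂ (Fin 5 → ℂ)) : Prop :=
  Module.finrank ℂ P = 3 ∧ Module.finrank ℂ L = 2 ∧ Module.finrank ℂ L' = 2 ∧
    ∃ l m : Module.Dual ℂ (Fin 5 → ℂ),
      P ⊓ LinearMap.ker l = L ∧ P ⊓ LinearMap.ker m = L' ∧
        ∀ x ∈ P, MvPolynomial.eval x F = l x ^ 2 * m x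

/-- `L` is a line of the second type on `X`: there is a unique plane `P ⊃ L` with
`P ∩ X = 2L ∪ L'` for some line `L'`. -/
def IsSecondType (F : MvPolynomial (Fin 5) ℂ) (L : Submodule ℂ (Fin 5 → ℂ)) : Prop :=
  ∃! P : Submodule ℂ (Fin 5 → ℂ), ∃ L', PlaneSection F P L L'

/-- `L` is a triple line on `X`: there is a plane `P ⊃ L` with `P ∩ X = 3L`. -/
def IsTripleLine (F : MvPolynomial (Fin 5) ℂ) (L : Submodule ℂ (Fin 5 → ℂ)) : Prop :=
  ∃ P : Submodule ℂ (Fin 5 → ℂ), PlaneSection F P L L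

/-! ### The standard affine charts of the Grassmannian of lines

A chart is given by a splitting `e : Fin 2 ⊕ Fin 3 ≃ Fin 5` of the five homogeneous coordinates.
With `i = e (inl 0)` and `j = e (inl 1)` it is the chart `p_{i,j} ≠ 0`; it is isomorphic to `ℂ⁶`, and
its coordinates `X (u, k)` are, up to signs, the other Plücker coordinates involving `i` or `j`,
normalised by `p_{i,j} = 1`. -/

/-- The coordinate ring of a chart. -/
abbrev ChartRing : Type := MvPolynomial (Fin 2 × Fin 3) ℂ

/-- The two points `v₀`, `v₁` spanning the general line of a chart: `v_u` has coordinate `1` at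
`e (inl u)`, coordinate `0` at the other `e (inl u')`, and coordinate `X (u, k)` at `e (inr k)`. -/
def chartVec (e : Fin 2 ⊕ Fin 3 ≃ Fin 5) (u : Fin 2) (i : Fin 5) : ChartRing :=
  Sum.elim (fun u' => if u' = u then 1 else 0) (fun k => MvPolynomial.X (u, k)) (e.symm i)

/-- The line with coordinates `a` in a chart. -/
def chartLine (e : Fin 2 ⊕ Fin 3 ≃ Fin 5) (a : Fin 2 × Fin 3 → ℂ) : Submodule ℂ (Fin 5 → ℂ) :=
  Submodule.span ℂ (Set.range fun (u : Fin 2) (i : Fin 5) => MvPolynomial.eval a (chartVec e u i))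

/-- The coefficient of `t₀ⁱ t₁ʲ` in `G (t₀ v₀ + t₁ v₁)`, a polynomial function on the chart. -/
def lineCoeff (e : Fin 2 ⊕ Fin 3 ≃ Fin 5) (G : MvPolynomial (Fin 5) ℂ) (i j : ℕ) : ChartRing :=
  MvPolynomial.coeff (Finsupp.single (0 : Fin 2) i + Finsupp.single (1 : Fin 2) j)
    (MvPolynomial.aeval
      (fun n : Fin 5 => ∑ u : Fin 2,
        (MvPolynomial.X u * MvPolynomial.C (chartVec e u n) : MvPolynomial (Fin 2) ChartRing)) G)

/-- The determinant of the `3 × 3` matrix whose columns are the coefficients (at `t₀²`, `t₀ t₁`,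
`t₁²`) of the three partial derivatives `∂F/∂x_{e (inr k)}` along the general line. -/
def secondTypeDet (e : Fin 2 ⊕ Fin 3 ≃ Fin 5) (F : MvPolynomial (Fin 5) ℂ) : ChartRing :=
  Matrix.det (Matrix.of fun r k : Fin 3 =>
    lineCoeff e (MvPolynomial.pderiv (e (Sum.inr k)) F) (2 - (r : ℕ)) (r : ℕ))

/-- The ideal of the curve `M(X)` of lines of the second type in a chart: the four equations of the
Fano surface `F(X)`, and the equation of `M(X)` in `F(X)`. -/
def curveIdeal (e : Fin 2 ⊕ Fin 3 ≃ Fin 5) (F : MvPolynomial (Fin 5) ℂ) : Ideal ChartRing :=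
  Ideal.span {lineCoeff e F 3 0, lineCoeff e F 2 1, lineCoeff e F 1 2, lineCoeff e F 0 3,
    secondTypeDet e F}

/-- The coordinate ring of `M(X)` in a chart. -/
abbrev CurveRing (e : Fin 2 ⊕ Fin 3 ≃ Fin 5) (F : MvPolynomial (Fin 5) ℂ) : Type :=
  ChartRing ⧸ curveIdeal e F

/-- The point with coordinates `a` of the chart lies on `M(X)`. -/
def MemCurve (e : Fin 2 ⊕ Fin 3 ≃ Fin 5) (F : MvPolynomial (Fin 5) ℂ)
    (a : Fin 2 × Fin 3 → ℂ) : Prop :=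
  ∀ f ∈ curveIdeal e F, MvPolynomial.eval a f = 0

/-- The maximal ideal of a closed point of `M(X)` in the coordinate ring of `M(X)` in a chart: the
kernel of the evaluation at that point. -/
def pointIdeal {e : Fin 2 ⊕ Fin 3 ≃ Fin 5} {F : MvPolynomial (Fin 5) ℂ}
    {a : Fin 2 × Fin 3 → ℂ} (h : MemCurve e F a) : Ideal (CurveRing e F) :=
  RingHom.ker (Ideal.Quotient.lift (curveIdeal e F) (MvPolynomial.eval a) h)

instance pointIdeal_isPrime {e : Fin 2 ⊕ Fin 3 ≃ Fin 5} {F : MvPolynomial (Fin 5) ℂ}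
    {a : Fin 2 × Fin 3 → ℂ} (h : MemCurve e F a) : (pointIdeal h).IsPrime :=
  RingHom.ker_isPrime _

/-- `L` is a singular point of the curve `M(X)`: it is a point of `M(X)` at which the local ring of
`M(X)`, computed in a chart containing `L`, is not regular. -/
def IsSingularPoint (F : MvPolynomial (Fin 5) ℂ) (L : Submodule ℂ (Fin 5 → ℂ)) : Prop :=
  ∃ (e : Fin 2 ⊕ Fin 3 ≃ Fin 5) (a : Fin 2 × Fin 3 → ℂ) (h : MemCurve e F a),
    chartLine e a = L ∧ ¬ IsRegularLocalRing (Localization.AtPrime (pointIdeal h))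

end CubicThreefold

end

/-! Polarize `F` to the symmetric trilinear form `polar`. If the line spanned by v₀, v₁ lies on X,
its span with a further vector n meets X doubly along the line iff polar(vᵢ, vⱼ, n) = 0 for all i,
j, that is, iff the coordinates c of n lie in the kernel of `derivMatrix`, whose determinant is the
fifth equation up to the factor 54. On that plane F(x + zn) = z²(3 polar(x, n, n) + z polar(n, n,
n)) for x on the line. The residual line exists because X contains no plane (`plane_not_subset`),
and it is the line itself exactly when m_u = polar(v_u, n, n) vanishes for both u.

Smoothness forbids a common zero of the derivatives on the line. The relation given by c expresses
one of the three quadratics through the other two, so these two are coprime: their resultant is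
nonzero (`derivMatrix_resultant_ne_zero`) and they have no linear syzygy. Hence the tangent space of
the Fano surface is the plane of vectors (l_u c_k) (`eq_tangent_of_fanoDiff_eq_zero`), the four Fano
equations have independent differentials, and c is unique up to a scalar. This settles the closed
points.

Let α, β, γ be the 2 × 2 minors of the two chosen columns and q(l) = αl₀² + βl₀l₁ + γl₁², whose
discriminant is that resultant. On the tangent plane the linear part of the determinant is, up to a
nonzero constant, the bilinear form of q paired with m (`taylorForm_secondTypeDet_tangent`), so it
is nonzero unless the line is triple. At a triple line, after subtracting a combination of the Fano
equations, the quadratic part is a nonzero multiple of polar(n, n, n) q(l). The tangent cone is thus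
one line, or two distinct lines.

`LocalBranches` transfers this to local rings without completions. It says that a polynomial whose
leading form vanishes on these lines gains order modulo I, and that leading forms of elements of the
radical of I vanish on them; the latter is `eval_taylorForm_eq_zero`, an open mapping argument.
Successive approximation and Krull's intersection theorem then give reducedness. By Nakayama, one
branch makes the maximal ideal principal, while two branches bound the dimension by one and prevent
the maximal ideal from being principal. -/

noncomputable section
open MvPolynomial Filter Topology

namespace CubicThreefold

/-! ### Taylor forms, leading forms and tangent directions -/

section Taylor

variable {σ : Type*}

/-- Translation of polynomials: `f (X + a)`. -/
def shift (a : σ → ℂ) : MvPolynomial σ ℂ →ₐ[ℂ] MvPolynomial σ ℂ :=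
  aeval fun i => X i + C (a i)

lemma eval_shift (a y : σ → ℂ) (f : MvPolynomial σ ℂ) :
    eval y (shift a f) = eval (a + y) f := by
  rw [shift, aeval_def, eval_eval₂, eval₂_eq_eval_map]
  have h : (eval y).comp (algebraMap ℂ (MvPolynomial σ ℂ)) = RingHom.id ℂ := by
    ext; simp
  rw [h, MvPolynomial.map_id]
  congr 2
  funext i
  simp [add_comm]

lemma shift_shift_neg (a : σ → ℂ) (f : MvPolynomial σ ℂ) : shift a (shift (-a) f) = f :=
  MvPolynomial.funext fun y => by simp [eval_shift]

lemma shift_neg_shift (a : σ → ℂ) (f : MvPolynomial σ ℂ) : shift (-a) (shift a f) = f :=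
  MvPolynomial.funext fun y => by simp [eval_shift]

/-- The form of degree `n` in the Taylor expansion of `f` at `a`. -/
def taylorForm (a : σ → ℂ) (n : ℕ) (f : MvPolynomial σ ℂ) : MvPolynomial σ ℂ :=
  homogeneousComponent n (shift a f)

lemma taylorForm_isHomogeneous (a : σ → ℂ) (n : ℕ) (f : MvPolynomial σ ℂ) :
    (taylorForm a n f).IsHomogeneous n :=
  homogeneousComponent_isHomogeneous _ _

/-- Restriction of a polynomial to the line through `a` with direction `y`. -/
def toLine (a y : σ → ℂ) : MvPolynomial σ ℂ →ₐ[ℂ] Polynomial ℂ :=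
  aeval fun i => Polynomial.C (a i) + Polynomial.X * Polynomial.C (y i)

lemma eval_toLine (a y : σ → ℂ) (t : ℂ) (f : MvPolynomial σ ℂ) :
    (toLine a y f).eval t = eval (a + t • y) f := by
  rw [toLine, ← Polynomial.coe_evalRingHom, aeval_def, ← coe_eval₂Hom, ← RingHom.comp_apply,
    comp_eval₂Hom]
  simp only [coe_eval₂Hom, eval]
  congr 1
  · ext; simp
  · funext i; simpa using mul_comm _ _

lemma coeff_toLine_zero (y : σ → ℂ) (k : ℕ) (p : MvPolynomial σ ℂ) :
    (toLine 0 y p).coeff k = eval y (homogeneousComponent k p) := by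
  induction p using MvPolynomial.induction_on' with
  | monomial d c =>
    have h1 : toLine 0 y (monomial d c)
        = Polynomial.C (c * d.prod fun i e => y i ^ e) * Polynomial.X ^ d.degree := by
      have h2 : (Polynomial.X : Polynomial ℂ) ^ d.degree = ∏ i ∈ d.support, Polynomial.X ^ d i :=
        (Finset.prod_pow_eq_pow_sum _ _ _).symm
      simp only [toLine, Pi.zero_apply, map_zero, zero_add, aeval_monomial, mul_pow, map_mul,
        Finsupp.prod, map_prod, map_pow, Polynomial.algebraMap_eq, h2, Finset.prod_mul_distrib]
      ring
    rw [h1, Polynomial.coeff_C_mul_X_pow]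
    by_cases h : d.degree = k
    · rw [homogeneousComponent_eq_self (n := k) (isHomogeneous_monomial c h), if_pos h.symm,
        eval_monomial]
    · rw [if_neg (Ne.symm h), homogeneousComponent_eq_zero', map_zero]
      intro e he
      rwa [Finset.mem_singleton.mp (support_monomial_subset he)]
  | add p q hp hq => simp [hp, hq]

lemma toLine_zero_of_isHomogeneous {n : ℕ} {p : MvPolynomial σ ℂ} (hp : p.IsHomogeneous n)
    (y : σ → ℂ) : toLine 0 y p = Polynomial.C (eval y p) * Polynomial.X ^ n := by
  ext k
  rw [coeff_toLine_zero, homogeneousComponent_of_mem hp, Polynomial.coeff_C_mul_X_pow]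
  split_ifs <;> simp

/-- Along `a + t y` the Taylor form of degree `k` scales as `t ^ k`. Identities between Taylor forms
are thereby reduced to polynomials in one variable. -/
lemma coeff_toLine (a y : σ → ℂ) (k : ℕ) (f : MvPolynomial σ ℂ) :
    (toLine a y f).coeff k = eval y (taylorForm a k f) := by
  rw [taylorForm, ← coeff_toLine_zero]
  congr 1
  refine Polynomial.funext fun t => ?_
  rw [eval_toLine, eval_toLine, eval_shift]
  simp

lemma taylorForm_eval_eq_coeff (a y : σ → ℂ) (f : MvPolynomial σ ℂ) (q : Polynomial ℂ)
    (h : ∀ t : ℂ, eval (a + t • y) f = q.eval t) (k : ℕ) :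
    eval y (taylorForm a k f) = q.coeff k := by
  rw [← coeff_toLine]
  congr 1
  exact Polynomial.funext fun t => by rw [eval_toLine, h]

/-- The maximal ideal of a point of affine space. -/
def maxIdeal (a : σ → ℂ) : Ideal (MvPolynomial σ ℂ) := RingHom.ker (eval a)

lemma mem_maxIdeal {a : σ → ℂ} {f : MvPolynomial σ ℂ} : f ∈ maxIdeal a ↔ eval a f = 0 := Iff.rfl

lemma mem_maxIdeal_pow {a : σ → ℂ} {n : ℕ} {f : MvPolynomial σ ℂ} :
    f ∈ maxIdeal a ^ n ↔ ∀ k < n, taylorForm a k f = 0 := by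
  let E : MvPolynomial σ ℂ ≃+* MvPolynomial σ ℂ :=
    RingEquiv.ofRingHom (shift a).toRingHom (shift (-a)).toRingHom
      (RingHom.ext fun f => shift_shift_neg a f) (RingHom.ext fun f => shift_neg_shift a f)
  -- Translation carries the ideal of `a` to the ideal of the variables, whose powers are detected
  -- by the vanishing of coefficients of low degree.
  have hE : maxIdeal a = (idealOfVars σ ℂ).map E.symm := by
    rw [Ideal.map_symm]
    ext f
    have h0 : f ∈ Ideal.comap E (idealOfVars σ ℂ) ↔ shift a f ∈ idealOfVars σ ℂ ^ 1 := by
      rw [pow_one]; rfl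
    rw [mem_maxIdeal, h0, mem_pow_idealOfVars_iff']
    have h1 : eval a f = coeff 0 (shift a f) := by
      have := eval_shift a 0 f
      rw [add_zero] at this
      rw [← this, ← constantCoeff_eq, MvPolynomial.eval_zero]
    constructor
    · intro h x hx
      have : x = 0 := by
        rw [← Finsupp.degree_eq_zero_iff]; omega
      rw [this, ← h1, h]
    · intro h
      rw [h1]
      exact h 0 (by simp)
  rw [hE, ← Ideal.map_pow, Ideal.map_symm]
  have h0 : f ∈ Ideal.comap E (idealOfVars σ ℂ ^ n) ↔ shift a f ∈ idealOfVars σ ℂ ^ n := Iff.rfl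
  rw [h0, mem_pow_idealOfVars_iff']
  constructor
  · intro h k hk
    ext d
    rw [taylorForm, coeff_homogeneousComponent]
    split_ifs with hd
    · rw [h d (by rw [hd]; exact hk)]; simp
    · simp
  · intro h x hx
    have := congrArg (coeff x) (h x.degree hx)
    rwa [taylorForm, coeff_homogeneousComponent, if_pos rfl, coeff_zero] at this

lemma taylorForm_sub (a : σ → ℂ) (n : ℕ) (f g : MvPolynomial σ ℂ) :
    taylorForm a n (f - g) = taylorForm a n f - taylorForm a n g := by simp [taylorForm]

lemma taylorForm_sum {ι : Type*} (s : Finset ι) (a : σ → ℂ) (n : ℕ) (f : ι → MvPolynomial σ ℂ) :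
    taylorForm a n (∑ i ∈ s, f i) = ∑ i ∈ s, taylorForm a n (f i) := by simp [taylorForm]

lemma taylorForm_shift_neg {a : σ → ℂ} {n : ℕ} {p : MvPolynomial σ ℂ} (hp : p.IsHomogeneous n)
    (k : ℕ) : taylorForm a k (shift (-a) p) = if k = n then p else 0 := by
  rw [taylorForm, shift_shift_neg]
  exact homogeneousComponent_of_mem hp

/-- Leading forms multiply. -/
lemma taylorForm_mul {a : σ → ℂ} {m n : ℕ} {f g : MvPolynomial σ ℂ} (hf : f ∈ maxIdeal a ^ m)
    (hg : g ∈ maxIdeal a ^ n) :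
    taylorForm a (m + n) (f * g) = taylorForm a m f * taylorForm a n g := by
  refine MvPolynomial.funext fun y => ?_
  rw [map_mul, ← coeff_toLine, ← coeff_toLine, ← coeff_toLine, map_mul, Polynomial.coeff_mul]
  rw [mem_maxIdeal_pow] at hf hg
  rw [Finset.sum_eq_single (m, n)]
  · rintro ⟨i, j⟩ hij hne
    rw [Finset.HasAntidiagonal.mem_antidiagonal] at hij
    by_cases hi : i < m
    · rw [coeff_toLine, hf i hi]; simp
    · have hj : j < n := by
        by_contra hj
        exact hne (Prod.ext (by simp at hij ⊢; omega) (by simp at hij ⊢; omega))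
      rw [coeff_toLine a y j, hg j hj]; simp
  · simp

lemma homogeneousComponent_mul_right {n r : ℕ} (c : MvPolynomial σ ℂ) {p : MvPolynomial σ ℂ}
    (hp : p.IsHomogeneous r) :
    homogeneousComponent n (c * p) = if r ≤ n then homogeneousComponent (n - r) c * p else 0 := by
  refine MvPolynomial.funext fun y => ?_
  rw [← coeff_toLine_zero, map_mul, toLine_zero_of_isHomogeneous hp, ← mul_assoc,
    Polynomial.coeff_mul_X_pow']
  split_ifs
  · rw [Polynomial.coeff_mul_C, coeff_toLine_zero, map_mul]
  · simp

/-- If the leading form of `f` lies in the ideal of the leading forms of the `G i`, then `f` can be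
improved by an element of the ideal of the `G i`. -/
lemma exists_sub_mem_maxIdeal_pow {ι : Type*} [Fintype ι] {G : ι → MvPolynomial σ ℂ}
    {r : ι → ℕ} {a : σ → ℂ} (hG : ∀ i, G i ∈ maxIdeal a ^ r i) {n : ℕ} {f : MvPolynomial σ ℂ}
    (hf : f ∈ maxIdeal a ^ n)
    (hs : taylorForm a n f ∈ Ideal.span (Set.range fun i => taylorForm a (r i) (G i))) :
    ∃ g ∈ Ideal.span (Set.range G), f - g ∈ maxIdeal a ^ (n + 1) := by
  obtain ⟨c, hc⟩ := Ideal.mem_span_range_iff_exists_fun.mp hs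
  -- Only the component of `c i` of degree `n - r i` contributes in degree `n`. The case split
  -- guards against truncated subtraction when `r i > n`.
  let c' : ι → MvPolynomial σ ℂ := fun i =>
    if r i ≤ n then homogeneousComponent (n - r i) (c i) else 0
  have hc' : taylorForm a n f = ∑ i, c' i * taylorForm a (r i) (G i) := by
    rw [← homogeneousComponent_eq_self (taylorForm_isHomogeneous a n f), ← hc, map_sum]
    refine Finset.sum_congr rfl fun i _ => ?_
    rw [homogeneousComponent_mul_right _ (taylorForm_isHomogeneous a (r i) (G i))]
    simp only [c']
    split_ifs <;> simp
  have hmem : ∀ i, shift (-a) (c' i) ∈ maxIdeal a ^ (n - r i) := by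
    intro i
    simp only [c']
    split_ifs with h
    · rw [mem_maxIdeal_pow]
      intro k hk
      rw [taylorForm_shift_neg (homogeneousComponent_isHomogeneous _ _), if_neg hk.ne]
    · simp
  have hprod : ∀ i, taylorForm a n (shift (-a) (c' i) * G i) = c' i * taylorForm a (r i) (G i) := by
    intro i
    by_cases h : r i ≤ n
    · have := taylorForm_mul (hmem i) (hG i)
      rw [Nat.sub_add_cancel h] at this
      rw [this]
      simp only [c', if_pos h]
      rw [taylorForm_shift_neg (homogeneousComponent_isHomogeneous _ _), if_pos rfl]
    · simp [c', h, taylorForm]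
  have hlow : ∀ i, shift (-a) (c' i) * G i ∈ maxIdeal a ^ n := by
    intro i
    by_cases h : r i ≤ n
    · have := Ideal.mul_mem_mul (hmem i) (hG i)
      rwa [← pow_add, Nat.sub_add_cancel h] at this
    · simp [c', h]
  refine ⟨∑ i, shift (-a) (c' i) * G i, Ideal.sum_mem _ fun i _ =>
    Ideal.mul_mem_left _ _ (Ideal.subset_span ⟨i, rfl⟩), ?_⟩
  rw [mem_maxIdeal_pow]
  intro k hk
  rcases Nat.lt_succ_iff_lt_or_eq.mp hk with hk | rfl
  · rw [taylorForm_sub, mem_maxIdeal_pow.mp hf k hk,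
      mem_maxIdeal_pow.mp (Ideal.sum_mem _ fun i _ => hlow i) k hk, sub_zero]
  · rw [taylorForm_sub, taylorForm_sum, hc', sub_eq_zero]
    exact Finset.sum_congr rfl fun i _ => (hprod i).symm

/-- `f (a + t y) / t ^ r` as a function of `(t, y)`, for `f` of order at least `r` at `a`. -/
def blowup (a : σ → ℂ) (r : ℕ) (f : MvPolynomial σ ℂ) (p : ℂ × (σ → ℂ)) : ℂ :=
  ∑ k ∈ Finset.range ((shift a f).totalDegree + 1), p.1 ^ k * eval p.2 (taylorForm a (r + k) f)

lemma eval_eq_pow_mul_blowup {a : σ → ℂ} {r : ℕ} {f : MvPolynomial σ ℂ}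
    (hf : f ∈ maxIdeal a ^ r) (t : ℂ) (y : σ → ℂ) :
    eval (a + t • y) f = t ^ r * blowup a r f (t, y) := by
  have hdeg : (toLine a y f).natDegree < r + ((shift a f).totalDegree + 1) := by
    refine Nat.lt_of_le_of_lt (m := (shift a f).totalDegree) ?_ (by omega)
    rw [Polynomial.natDegree_le_iff_coeff_eq_zero]
    intro k hk
    rw [coeff_toLine, taylorForm, homogeneousComponent_eq_zero _ _ hk, map_zero]
  rw [← eval_toLine, Polynomial.eval_eq_sum_range' hdeg, Finset.sum_range_add,
    Finset.sum_eq_zero, zero_add, blowup, Finset.mul_sum]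
  · refine Finset.sum_congr rfl fun k _ => ?_
    rw [coeff_toLine, pow_add]
    ring
  · intro k hk
    rw [coeff_toLine, mem_maxIdeal_pow.mp hf k (Finset.mem_range.mp hk)]
    simp

lemma blowup_zero (a : σ → ℂ) (r : ℕ) (f : MvPolynomial σ ℂ) (y : σ → ℂ) :
    blowup a r f (0, y) = eval y (taylorForm a r f) := by
  simp [blowup, Finset.sum_range_succ']

lemma contDiff_blowup [Fintype σ] (a : σ → ℂ) (r : ℕ) (f : MvPolynomial σ ℂ) :
    ContDiff ℂ 1 (blowup a r f) := by
  unfold blowup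
  refine ContDiff.sum fun k _ => ?_
  exact (contDiff_fst.pow k).mul
    ((AnalyticOnNhd.eval_mvPolynomial (taylorForm a (r + k) f)).contDiff.comp contDiff_snd)

/-- If the leading forms of the `G i` vanish at `y` and have linearly independent differentials
there, then `y` is a tangent direction of the common zero locus, and so the leading form of every
`f` vanishing on that locus vanishes at `y`. -/
lemma eval_taylorForm_eq_zero [Fintype σ] {ι : Type*} [Fintype ι] {G : ι → MvPolynomial σ ℂ}
    {r : ι → ℕ} {a y : σ → ℂ} (hG : ∀ i, G i ∈ maxIdeal a ^ r i)
    (hy : ∀ i, eval y (taylorForm a (r i) (G i)) = 0)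
    (hd : ∀ z : ι → ℂ, ∃ w : σ → ℂ, ∀ i,
      HasDerivAt (fun t : ℂ => eval (y + t • w) (taylorForm a (r i) (G i))) (z i) 0)
    {n : ℕ} {f : MvPolynomial σ ℂ} (hf : f ∈ maxIdeal a ^ n)
    (hv : ∀ x, (∀ i, eval x (G i) = 0) → eval x f = 0) :
    eval y (taylorForm a n f) = 0 := by
  by_contra hne
  -- Deformation to the tangent cone: for `t ≠ 0` the second component is the system `G i` at `a + t
  -- y`, rescaled by `t ^ r i`; at `t = 0` it is the system of leading forms.
  let Φ : ℂ × (σ → ℂ) → ℂ × (ι → ℂ) := fun p => (p.1, fun i => blowup a (r i) (G i) p)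
  have hΦ : ContDiff ℂ 1 Φ :=
    contDiff_fst.prodMk (contDiff_pi.mpr fun i => contDiff_blowup a (r i) (G i))
  have hst : HasStrictFDerivAt Φ (fderiv ℂ Φ (0, y)) (0, y) :=
    hΦ.contDiffAt.hasStrictFDerivAt (by simp)
  -- The derivative is block triangular: the identity on `t`, and the differentials of the leading
  -- forms on the slice `t = 0`, where `hd` supplies every value.
  have hsurj : (fderiv ℂ Φ (0, y)).range = ⊤ := by
    rw [LinearMap.range_eq_top]
    have h1 : ∀ w : σ → ℂ, ∀ z : ι → ℂ, (∀ i,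
        HasDerivAt (fun t : ℂ => eval (y + t • w) (taylorForm a (r i) (G i))) (z i) 0) →
        fderiv ℂ Φ (0, y) (0, w) = (0, z) := by
      intro w z hw
      have hline : HasDerivAt (fun t : ℂ => ((0 : ℂ), y + t • w)) ((0 : ℂ), w) 0 := by
        refine (hasDerivAt_const _ _).prodMk ?_
        simpa using ((hasDerivAt_id (0 : ℂ)).smul_const w).const_add y
      have e0 : ((0 : ℂ), y + (0 : ℂ) • w) = (0, y) := by simp
      have hc : HasDerivAt (Φ ∘ fun t : ℂ => ((0 : ℂ), y + t • w))
          (fderiv ℂ Φ (0, y) (0, w)) 0 :=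
        HasFDerivAt.comp_hasDerivAt (0 : ℂ) (by rw [e0]; exact hst.hasFDerivAt) hline
      have hc' : HasDerivAt (Φ ∘ fun t : ℂ => ((0 : ℂ), y + t • w)) ((0 : ℂ), z) 0 := by
        refine (hasDerivAt_const _ _).prodMk (hasDerivAt_pi.mpr fun i => ?_)
        simpa only [Function.comp, blowup_zero] using hw i
      exact hc.unique hc'
    rintro ⟨s, z⟩
    obtain ⟨w, hw⟩ := hd (z - (fderiv ℂ Φ (0, y) (s, 0)).2)
    refine ⟨(s, w), ?_⟩
    have hs : (fderiv ℂ Φ (0, y) (s, 0)).1 = s := by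
      have hfst : HasFDerivAt (fun p => (Φ p).1)
          ((ContinuousLinearMap.fst ℂ ℂ (ι → ℂ)).comp (fderiv ℂ Φ (0, y))) (0, y) :=
        (ContinuousLinearMap.fst ℂ ℂ (ι → ℂ)).hasFDerivAt.comp _ hst.hasFDerivAt
      have hfst' : HasFDerivAt (fun p => (Φ p).1) (ContinuousLinearMap.fst ℂ ℂ (σ → ℂ)) (0, y) :=
        hasFDerivAt_fst
      have := congrArg (fun l => l (s, (0 : σ → ℂ))) (hfst.unique hfst')
      simpa using this
    have hsplit : ((s, w) : ℂ × (σ → ℂ)) = (s, 0) + (0, w) := by simp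
    change fderiv ℂ Φ (0, y) (s, w) = (s, z)
    rw [hsplit, map_add, h1 w _ hw]
    ext <;> simp [hs]
  have hopen := hst.map_nhds_eq_of_surj hsurj
  -- By openness of `Φ` near `(0, y)`, the neighbourhood where the rescaled `f` is nonzero hits `(t,
  -- 0)` for some `t ≠ 0`. This yields a common zero of the `G i` at which `f` does not vanish.
  have hU : {p : ℂ × (σ → ℂ) | blowup a n f p ≠ 0} ∈ 𝓝 ((0 : ℂ), y) :=
    ((contDiff_blowup a n f).continuous.continuousAt).eventually_ne (by rwa [blowup_zero])
  have himg := image_mem_map (m := Φ) hU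
  have h0 : Φ (0, y) = (0, 0) := by
    ext i
    · rfl
    · simp [Φ, blowup_zero, hy i]
  rw [hopen, h0] at himg
  have hcont : Tendsto (fun t : ℂ => (t, (0 : ι → ℂ))) (𝓝[≠] 0) (𝓝 (0, 0)) :=
    tendsto_nhdsWithin_of_tendsto_nhds
      ((continuous_id.prodMk continuous_const).tendsto' _ _ rfl)
  obtain ⟨t, ⟨⟨s, w⟩, hp, hpt⟩, ht⟩ :=
    ((hcont.eventually himg).and self_mem_nhdsWithin).exists
  simp only [Φ, Prod.mk.injEq] at hpt
  obtain ⟨rfl, hpt⟩ := hpt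
  have hz : eval (a + s • w) f = 0 := by
    refine hv _ fun i => ?_
    rw [eval_eq_pow_mul_blowup (hG i), congrFun hpt i, Pi.zero_apply, mul_zero]
  rw [eval_eq_pow_mul_blowup hf] at hz
  exact (mul_ne_zero (pow_ne_zero _ ht) hp) hz

end Taylor

/-- Nakayama's lemma. It is applied to the maximal ideal at a smooth point and to its square at a
node. -/
lemma le_of_le_sup_maximalIdeal_mul {S : Type*} [CommRing S] [IsLocalRing S] [IsNoetherianRing S]
    {J K : Ideal S} (h : J ≤ K ⊔ IsLocalRing.maximalIdeal S * J) : J ≤ K :=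
  Submodule.le_of_le_smul_of_le_jacobson_bot (IsNoetherian.noetherian _)
    (IsLocalRing.jacobson_eq_maximalIdeal _ bot_ne_top).ge h

/-! ### From tangent cones to reducedness and regularity -/

section LocalBranches

variable {σ : Type*}

/-- The tangent cone at `a` of the subscheme defined by `I` is the reduced union of the lines
through the vectors `Y j`, and each of these lines is tangent to the zero locus of `I`. -/
structure LocalBranches (I : Ideal (MvPolynomial σ ℂ)) (a : σ → ℂ) {m : ℕ}
    (Y : Fin m → σ → ℂ) : Prop where
  exists_sub_mem : ∀ (n : ℕ) (f : MvPolynomial σ ℂ), f ∈ maxIdeal a ^ n →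
    (∀ j, eval (Y j) (taylorForm a n f) = 0) → ∃ g ∈ I, f - g ∈ maxIdeal a ^ (n + 1)
  eval_eq_zero : ∀ (n : ℕ) (f : MvPolynomial σ ℂ), f ∈ maxIdeal a ^ n → f ∈ I.radical →
    ∀ j, eval (Y j) (taylorForm a n f) = 0

/-- Successive approximation: subtracting elements of `I` stays inside the radical, so the leading
form of each remainder again vanishes on the branches and the order can be raised once more. -/
lemma LocalBranches.exists_sub_mem_of_mem_radical {I : Ideal (MvPolynomial σ ℂ)} {a : σ → ℂ}
    {m : ℕ} {Y : Fin m → σ → ℂ} (h : LocalBranches I a Y) {f : MvPolynomial σ ℂ}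
    (hf : f ∈ I.radical) (n : ℕ) : ∃ g ∈ I, f - g ∈ maxIdeal a ^ n := by
  induction n with
  | zero => exact ⟨0, I.zero_mem, by simp⟩
  | succ n ih =>
    obtain ⟨g, hg, hfg⟩ := ih
    obtain ⟨g', hg', hfg'⟩ := h.exists_sub_mem n (f - g) hfg
      (h.eval_eq_zero n _ hfg (Ideal.sub_mem _ hf (Ideal.le_radical hg)))
    exact ⟨g + g', I.add_mem hg hg', by rwa [← sub_sub]⟩

lemma exists_eq_maxIdeal [Finite σ] {M : Ideal (MvPolynomial σ ℂ)} (hM : M.IsMaximal) :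
    ∃ a, M = maxIdeal a := by
  obtain ⟨a, rfl⟩ := isMaximal_iff_eq_vanishingIdeal_singleton.mp hM
  refine ⟨a, ?_⟩
  ext f
  rw [mem_vanishingIdeal_singleton_iff, mem_maxIdeal]
  rfl

/-- If `f` is in the radical but not in `I`, its annihilator modulo `I` lies in the maximal ideal
`M` of some point. There `f` belongs to every power of `M`, so Krull's intersection theorem gives `r
∈ M` with `r f = f`; then `1 - r` annihilates `f` and lies in `M`, which is absurd. -/
theorem isRadical_of_localBranches [Finite σ] {I : Ideal (MvPolynomial σ ℂ)}
    (h : ∀ a, (∀ f ∈ I, eval a f = 0) → ∃ (m : ℕ) (Y : Fin m → σ → ℂ), LocalBranches I a Y) :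
    I.IsRadical := by
  intro f hf
  by_contra hfI
  let π := Ideal.Quotient.mk I
  have hne : π f ≠ 0 := fun h0 => hfI (Ideal.Quotient.eq_zero_iff_mem.mp h0)
  let N : Ideal (MvPolynomial σ ℂ ⧸ I) := LinearMap.ker (LinearMap.toSpanSingleton _ _ (π f))
  have hN : ∀ r, r ∈ N ↔ r * π f = 0 := fun r => Iff.rfl
  have hNtop : N ≠ ⊤ := fun ht => hne (by
    have := (hN 1).mp (ht ▸ Submodule.mem_top)
    rwa [one_mul] at this)
  obtain ⟨M, hM, hNM⟩ := Ideal.exists_le_maximal N hNtop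
  have hMc : (M.comap π).IsMaximal :=
    Ideal.comap_isMaximal_of_surjective π Ideal.Quotient.mk_surjective
  obtain ⟨a, ha⟩ := exists_eq_maxIdeal hMc
  have hIa : ∀ g ∈ I, eval a g = 0 := by
    intro g hg
    rw [← mem_maxIdeal, ← ha, Ideal.mem_comap, Ideal.Quotient.eq_zero_iff_mem.mpr hg]
    exact M.zero_mem
  obtain ⟨m, Y, hY⟩ := h a hIa
  have hinf : π f ∈ (⨅ i : ℕ, M ^ i • ⊤ : Submodule (MvPolynomial σ ℂ ⧸ I)
      (MvPolynomial σ ℂ ⧸ I)) := by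
    rw [Submodule.mem_iInf]
    intro n
    obtain ⟨g, hg, hfg⟩ := hY.exists_sub_mem_of_mem_radical hf n
    have h1 : π f = π (f - g) := by
      rw [map_sub, Ideal.Quotient.eq_zero_iff_mem.mpr hg, sub_zero]
    rw [smul_eq_mul, Ideal.mul_top, h1]
    have h2 : (maxIdeal a).map π ≤ M := by rw [← ha]; exact Ideal.map_comap_le
    refine Ideal.pow_right_mono h2 n ?_
    rw [← Ideal.map_pow]
    exact Ideal.mem_map_of_mem π hfg
  obtain ⟨⟨r, hrM⟩, hr⟩ := (Ideal.mem_iInf_smul_pow_eq_bot_iff M (π f)).mp hinf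
  have h1 : 1 - r ∈ M := hNM ((hN _).mpr (by
    rw [sub_mul, one_mul, sub_eq_zero]; exact hr.symm))
  exact hM.ne_top ((Ideal.eq_top_iff_one _).mpr (by simpa using M.add_mem h1 hrM))

/-- The linear form with coefficients `l`, centred at `a`. -/
def centredForm [Fintype σ] (a l : σ → ℂ) : MvPolynomial σ ℂ := ∑ i, C (l i) * (X i - C (a i))

lemma centredForm_mem [Fintype σ] (a l : σ → ℂ) : centredForm a l ∈ maxIdeal a := by
  simp [centredForm, mem_maxIdeal]

lemma eval_taylorForm_centredForm [Fintype σ] (a l y : σ → ℂ) :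
    eval y (taylorForm a 1 (centredForm a l)) = ∑ i, l i * y i := by
  rw [taylorForm_eval_eq_coeff a y _ (Polynomial.C (∑ i, l i * y i) * Polynomial.X)]
  · simp
  · intro t
    simp only [centredForm, map_sum, map_mul, eval_C, map_sub, eval_X, Pi.add_apply, Pi.smul_apply,
      smul_eq_mul, add_sub_cancel_left]
    rw [Polynomial.eval_mul, Polynomial.eval_finsetSum, Polynomial.eval_X, Finset.sum_mul]
    exact Finset.sum_congr rfl fun i _ => by
      rw [Polynomial.eval_mul, Polynomial.eval_C, Polynomial.eval_C]; ring

lemma taylorForm_zero (a y : σ → ℂ) (f : MvPolynomial σ ℂ) :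
    eval y (taylorForm a 0 f) = eval a f := by
  rw [← coeff_toLine, Polynomial.coeff_zero_eq_eval_zero, eval_toLine]
  simp

variable {I : Ideal (MvPolynomial σ ℂ)} {a : σ → ℂ} (P : Ideal (MvPolynomial σ ℂ ⧸ I)) [P.IsPrime]

/-- The map from the polynomial ring to a local ring of the scheme defined by `I`. -/
def toLocal : MvPolynomial σ ℂ →+* Localization.AtPrime P :=
  (algebraMap (MvPolynomial σ ℂ ⧸ I) (Localization.AtPrime P)).comp (Ideal.Quotient.mk I)

lemma toLocal_eq_zero_of_mem {f : MvPolynomial σ ℂ} (hf : f ∈ I) : toLocal P f = 0 := by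
  rw [toLocal, RingHom.comp_apply, Ideal.Quotient.eq_zero_iff_mem.mpr hf, map_zero]

variable {P} (hP : P.comap (Ideal.Quotient.mk I) = maxIdeal a)
include hP

lemma isUnit_toLocal {f : MvPolynomial σ ℂ} (hf : f ∉ maxIdeal a) : IsUnit (toLocal P f) :=
  IsLocalization.map_units (Localization.AtPrime P)
    (⟨Ideal.Quotient.mk I f, fun h => hf (hP ▸ h)⟩ : P.primeCompl)

lemma exists_mul_mem_of_toLocal_eq_zero {f : MvPolynomial σ ℂ} (hf : toLocal P f = 0) :
    ∃ u, u ∉ maxIdeal a ∧ u * f ∈ I := by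
  obtain ⟨⟨c, hc⟩, h⟩ := (IsLocalization.map_eq_zero_iff P.primeCompl
    (Localization.AtPrime P) (Ideal.Quotient.mk I f)).mp hf
  obtain ⟨u, rfl⟩ := Ideal.Quotient.mk_surjective c
  refine ⟨u, fun hu => hc ?_, ?_⟩
  · rw [← hP] at hu; exact hu
  · rwa [← Ideal.Quotient.eq_zero_iff_mem, map_mul]

lemma exists_mul_toLocal_eq (t : Localization.AtPrime P) :
    ∃ s p, s ∉ maxIdeal a ∧ t * toLocal P s = toLocal P p := by
  obtain ⟨⟨p, s, hs⟩, h⟩ := IsLocalization.surj P.primeCompl t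
  obtain ⟨p, rfl⟩ := Ideal.Quotient.mk_surjective p
  obtain ⟨s, rfl⟩ := Ideal.Quotient.mk_surjective s
  refine ⟨s, p, fun hu => hs ?_, h⟩
  rw [← hP] at hu; exact hu

lemma map_toLocal_maxIdeal :
    (maxIdeal a).map (toLocal P) = IsLocalRing.maximalIdeal (Localization.AtPrime P) := by
  rw [toLocal, ← Ideal.map_map, ← hP,
    Ideal.map_comap_of_surjective _ Ideal.Quotient.mk_surjective,
    Localization.AtPrime.map_eq_maximalIdeal]

lemma toLocal_mem_maximalIdeal {f : MvPolynomial σ ℂ} (hf : f ∈ maxIdeal a) :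
    toLocal P f ∈ IsLocalRing.maximalIdeal (Localization.AtPrime P) := by
  rw [← map_toLocal_maxIdeal hP]; exact Ideal.mem_map_of_mem _ hf

variable [Fintype σ]

/-- A point with one smooth branch is regular. -/
theorem isRegularLocalRing_of_localBranches {Y : Fin 1 → σ → ℂ} (h : LocalBranches I a Y)
    {l : σ → ℂ} (hl : ∑ i, l i * Y 0 i = 1) : IsRegularLocalRing (Localization.AtPrime P) := by
  let z := centredForm a l
  have hz : z ∈ maxIdeal a := centredForm_mem a l
  have hz1 : eval (Y 0) (taylorForm a 1 z) = 1 := by rw [eval_taylorForm_centredForm, hl]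
  let M := IsLocalRing.maximalIdeal (Localization.AtPrime P)
  -- Subtracting the right multiple of `z` kills the linear form on the branch, so modulo `I` the
  -- remainder has order two: `M ≤ (z) + M²`, and Nakayama applies.
  have hle : M ≤ Ideal.span {toLocal P z} := by
    refine le_of_le_sup_maximalIdeal_mul (S := Localization.AtPrime P) ?_
    change M ≤ _
    conv_lhs => rw [show M = (maxIdeal a).map (toLocal P) from (map_toLocal_maxIdeal hP).symm]
    rw [Ideal.map_le_iff_le_comap]
    intro x hx
    have hx' : x - C (eval (Y 0) (taylorForm a 1 x)) * z ∈ maxIdeal a ^ 1 := by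
      rw [pow_one]; exact Ideal.sub_mem _ hx (Ideal.mul_mem_left _ _ hz)
    obtain ⟨g, hg, hxg⟩ := h.exists_sub_mem 1 _ hx' (by
      intro j
      rw [Subsingleton.elim j 0, taylorForm_sub]
      have : taylorForm a 1 (C (eval (Y 0) (taylorForm a 1 x)) * z)
          = C (eval (Y 0) (taylorForm a 1 x)) * taylorForm a 1 z := by
        simp only [taylorForm, map_mul, shift, aeval_C, algebraMap_eq, homogeneousComponent_C_mul]
      rw [this]
      simp [hz1])
    have h1 : toLocal P x = toLocal P (C (eval (Y 0) (taylorForm a 1 x))) * toLocal P z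
        + toLocal P (x - C (eval (Y 0) (taylorForm a 1 x)) * z - g) := by
      rw [map_sub, toLocal_eq_zero_of_mem P hg, map_sub, map_mul]; ring
    rw [Ideal.mem_comap, h1]
    refine Submodule.add_mem_sup (Ideal.mul_mem_left _ _ (Ideal.mem_span_singleton_self _)) ?_
    rw [← pow_two]
    change _ ∈ IsLocalRing.maximalIdeal _ ^ 2
    rw [← map_toLocal_maxIdeal hP, ← Ideal.map_pow]
    exact Ideal.mem_map_of_mem _ hxg
  have hM : M = Ideal.span {toLocal P z} :=
    le_antisymm hle ((Ideal.span_singleton_le_iff_mem _).mpr (toLocal_mem_maximalIdeal hP hz))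
  apply IsRegularLocalRing.of_spanFinrank_maximalIdeal_le
  have h1 : (IsLocalRing.maximalIdeal (Localization.AtPrime P)).spanFinrank ≤ 1 := by
    change M.spanFinrank ≤ 1
    rw [hM]
    simpa using Submodule.spanFinrank_span_le_ncard_of_finite (R := Localization.AtPrime P)
      (Set.finite_singleton (toLocal P z))
  -- In dimension zero `z` would be nilpotent, giving `u * z ^ n ∈ I` with `u` nonzero at `a`. But
  -- the degree `n` form of this product takes the nonzero value `u(a)` on the branch.
  have h2 : (1 : WithBot ℕ∞) ≤ ringKrullDim (Localization.AtPrime P) := by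
    by_contra hlt
    have h0 : Ring.KrullDimLE 0 (Localization.AtPrime P) :=
      Ring.krullDimLE_iff.mpr (ENat.WithBot.lt_add_one_iff.mp (by simpa using hlt))
    have hnil : toLocal P z ∈ nilradical (Localization.AtPrime P) := by
      refine nilpotent_iff_mem_prime.mpr fun J hJ => ?_
      rw [IsLocalRing.eq_maximalIdeal (hJ.isMaximal' (R := Localization.AtPrime P))]
      exact toLocal_mem_maximalIdeal hP hz
    obtain ⟨n, hn⟩ := mem_nilradical.mp hnil
    rw [← map_pow] at hn
    obtain ⟨u, hu, huz⟩ := exists_mul_mem_of_toLocal_eq_zero hP hn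
    have hpow : ∀ n, z ^ n ∈ maxIdeal a ^ n ∧ eval (Y 0) (taylorForm a n (z ^ n)) = 1 := by
      intro n
      induction n with
      | zero => simp [taylorForm_zero]
      | succ n ih =>
        have hz' : z ∈ maxIdeal a ^ 1 := by rwa [pow_one]
        refine ⟨Ideal.pow_mem_pow hz _, ?_⟩
        rw [pow_succ, taylorForm_mul ih.1 hz', map_mul, ih.2, hz1, one_mul]
    have hu0 : u ∈ maxIdeal a ^ 0 := by simp
    have hmem : u * z ^ n ∈ maxIdeal a ^ (0 + n) := by
      rw [zero_add]; exact Ideal.mul_mem_left _ _ (hpow n).1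
    have := h.eval_eq_zero _ _ hmem (Ideal.le_radical huz) 0
    rw [taylorForm_mul hu0 (hpow n).1, map_mul, (hpow n).2, mul_one, taylorForm_zero] at this
    exact hu this
  exact le_trans (by exact_mod_cast h1) h2

/-- A point with two transversal branches is not regular. -/
theorem not_isRegularLocalRing_of_localBranches {Y : Fin 2 → σ → ℂ} (h : LocalBranches I a Y)
    (hl : ∀ v : Fin 2 → ℂ, ∃ l : σ → ℂ, ∀ j, ∑ i, l i * Y j i = v j) :
    ¬ IsRegularLocalRing (Localization.AtPrime P) := by
  intro hreg
  let M := IsLocalRing.maximalIdeal (Localization.AtPrime P)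
  have hpow1 : ∀ {f}, f ∈ maxIdeal a → f ∈ maxIdeal a ^ 1 := fun hf => by rwa [pow_one]
  -- Choose `z` equal to 1 on both tangent vectors. A product of two functions vanishing at `a`
  -- agrees on both vectors with `q z`, where the linear form `q` interpolates its two values, so
  -- `M² ≤ (z) + M³`. Nakayama gives `M² ≤ (z)`, and Krull's height theorem bounds the dimension.
  have hdim : ringKrullDim (Localization.AtPrime P) ≤ 1 := by
    obtain ⟨l, hl1⟩ := hl 1
    let z := centredForm a l
    have hz : z ∈ maxIdeal a := centredForm_mem a l
    have hz1 : ∀ j, eval (Y j) (taylorForm a 1 z) = 1 := fun j => by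
      rw [eval_taylorForm_centredForm, hl1]; rfl
    have hle : M ^ 2 ≤ Ideal.span {toLocal P z} := by
      refine le_of_le_sup_maximalIdeal_mul (S := Localization.AtPrime P) ?_
      rw [← pow_succ']
      have hM : ∀ n, M ^ n = (maxIdeal a ^ n).map (toLocal P) := fun n => by
        rw [Ideal.map_pow, map_toLocal_maxIdeal hP]
      rw [hM 2, hM (2 + 1), Ideal.map_le_iff_le_comap, pow_two, Ideal.mul_le]
      intro x hx x' hx'
      obtain ⟨q, hq⟩ := hl fun j =>
        eval (Y j) (taylorForm a 1 x) * eval (Y j) (taylorForm a 1 x')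
      have hqm := centredForm_mem a q
      have hmem : x * x' - centredForm a q * z ∈ maxIdeal a ^ 2 := by
        rw [pow_two]
        exact Ideal.sub_mem _ (Ideal.mul_mem_mul hx hx') (Ideal.mul_mem_mul hqm hz)
      obtain ⟨g, hg, hxg⟩ := h.exists_sub_mem 2 _ hmem (by
        intro j
        rw [taylorForm_sub, taylorForm_mul (m := 1) (n := 1) (hpow1 hx) (hpow1 hx'),
          taylorForm_mul (m := 1) (n := 1) (hpow1 hqm) (hpow1 hz)]
        simp only [map_sub, map_mul, hz1, eval_taylorForm_centredForm, hq]
        ring)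
      have h1 : toLocal P (x * x') = toLocal P (centredForm a q) * toLocal P z
          + toLocal P (x * x' - centredForm a q * z - g) := by
        rw [map_sub _ _ g, toLocal_eq_zero_of_mem P hg, map_sub, map_mul _ _ z]; ring
      rw [Ideal.mem_comap, h1]
      exact Submodule.add_mem_sup (Ideal.mul_mem_left _ _ (Ideal.mem_span_singleton_self _))
        (Ideal.mem_map_of_mem _ hxg)
    refine (IsLocalRing.maximalIdeal_height_eq_ringKrullDim
      (R := Localization.AtPrime P)).symm.trans_le ?_
    have hmin : M ∈ (Ideal.span {toLocal P z}).minimalPrimes := by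
      refine ⟨⟨Ideal.IsMaximal.isPrime inferInstance, ?_⟩, ?_⟩
      · exact (Ideal.span_singleton_le_iff_mem _).mpr (toLocal_mem_maximalIdeal hP hz)
      · rintro q ⟨hq, hzq⟩ -
        exact hq.le_of_pow_le (hle.trans hzq)
    have hprin : (Ideal.span {toLocal P z}).IsPrincipal := ⟨⟨_, rfl⟩⟩
    exact_mod_cast Ideal.height_le_one_of_isPrincipal_of_mem_minimalPrimes _ _ hmin
  have hfin : M.spanFinrank ≤ 1 := by
    have := hreg.spanFinrank_maximalIdeal
    rw [← this] at hdim
    exact_mod_cast hdim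
  obtain ⟨s, hs, hsM⟩ :=
    (IsNoetherian.noetherian M : M.FG).exists_span_finset_card_eq_spanFinrank
  obtain ⟨t, htM, ht⟩ : ∃ t ∈ M, M ≤ Ideal.span {t} := by
    rcases Nat.le_one_iff_eq_zero_or_eq_one.mp (hs ▸ hfin) with h0 | h1
    · rw [Finset.card_eq_zero] at h0
      exact ⟨0, M.zero_mem, by rw [← hsM, h0]; simp⟩
    · obtain ⟨t, rfl⟩ := Finset.card_eq_one.mp h1
      refine ⟨t, hsM ▸ Submodule.subset_span (by simp), ?_⟩
      rw [← hsM]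
      exact Submodule.span_mono (by simp)
  obtain ⟨s₀, p, hs₀, hp⟩ := exists_mul_toLocal_eq hP t
  have hpa : p ∈ maxIdeal a := by
    by_contra hpa
    have h1 := isUnit_toLocal hP hpa
    rw [← hp] at h1
    exact (IsLocalRing.mem_maximalIdeal _).mp htM (isUnit_of_mul_isUnit_left h1)
  -- If `p` generates the maximal ideal up to a unit, then every linear part restricted to the two
  -- branches is proportional to that of `p`. This contradicts the independence of the two tangent
  -- vectors, tested on the values (1, 0) and (0, 1).
  have hkey : ∀ x ∈ maxIdeal a, ∃ u c : ℂ, u ≠ 0 ∧ ∀ j,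
      u * eval (Y j) (taylorForm a 1 x) = c * eval (Y j) (taylorForm a 1 p) := by
    intro x hx
    obtain ⟨r, hr⟩ := Ideal.mem_span_singleton.mp (ht (toLocal_mem_maximalIdeal hP hx))
    obtain ⟨s₁, c, hs₁, hc⟩ := exists_mul_toLocal_eq hP r
    have h0 : toLocal P (s₀ * s₁ * x - c * p) = 0 := by
      rw [map_sub, map_mul, map_mul, map_mul, hr, ← hc, ← hp]; ring
    obtain ⟨u, hu, hux⟩ := exists_mul_mem_of_toLocal_eq_zero hP h0
    refine ⟨eval a (u * s₀ * s₁), eval a (u * c), ?_, fun j => ?_⟩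
    · rw [map_mul, map_mul]
      exact mul_ne_zero (mul_ne_zero hu hs₀) hs₁
    · have hm0 : ∀ f, f ∈ maxIdeal a ^ 0 := fun f => by simp
      have e : u * (s₀ * s₁ * x - c * p) = (u * s₀ * s₁) * x - (u * c) * p := by ring
      rw [e] at hux
      have h2 : (u * s₀ * s₁) * x - (u * c) * p ∈ maxIdeal a ^ 1 := by
        rw [pow_one]
        exact Ideal.sub_mem _ (Ideal.mul_mem_left _ _ hx) (Ideal.mul_mem_left _ _ hpa)
      have := h.eval_eq_zero 1 _ h2 (Ideal.le_radical hux) j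
      rw [taylorForm_sub, ← zero_add 1, taylorForm_mul (hm0 _) (hpow1 hx),
        taylorForm_mul (hm0 _) (hpow1 hpa)] at this
      simpa [taylorForm_zero, sub_eq_zero] using this
  have hval : ∀ v : Fin 2 → ℂ, ∃ u c : ℂ, u ≠ 0 ∧ ∀ j,
      u * v j = c * eval (Y j) (taylorForm a 1 p) := by
    intro v
    obtain ⟨l, hlv⟩ := hl v
    simpa only [eval_taylorForm_centredForm, hlv] using hkey _ (centredForm_mem a l)
  obtain ⟨u, c, hu, huc⟩ := hval ![1, 0]
  obtain ⟨u', c', hu', huc'⟩ := hval ![0, 1]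
  have h1 := huc 0
  have h2 := huc 1
  have h3 := huc' 0
  have h4 := huc' 1
  simp only [Matrix.cons_val_zero, Matrix.cons_val_one, mul_one, mul_zero] at h1 h2 h3 h4
  have hc : c ≠ 0 := by rintro rfl; simp [hu] at h1
  have hp1 : eval (Y 1) (taylorForm a 1 p) = 0 := by simpa [hc] using h2.symm
  rw [hp1, mul_zero] at h4
  exact hu' h4

end LocalBranches

/-! ### Branches from independent linear parts and one further equation -/

section Frame

variable {σ : Type*}

lemma eval_smul_of_isHomogeneous {n : ℕ} {p : MvPolynomial σ ℂ} (hp : p.IsHomogeneous n) (t : ℂ)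
    (y : σ → ℂ) : eval (t • y) p = t ^ n * eval y p := by
  have := eval_toLine 0 y t p
  rw [toLine_zero_of_isHomogeneous hp, zero_add] at this
  rw [← this, Polynomial.eval_mul, Polynomial.eval_C, Polynomial.eval_pow, Polynomial.eval_X]
  ring

lemma eval_add_of_isHomogeneous_one {p : MvPolynomial σ ℂ} (hp : p.IsHomogeneous 1)
    (y z : σ → ℂ) : eval (y + z) p = eval y p + eval z p := by
  rw [← mem_homogeneousSubmodule, homogeneousSubmodule_one_eq_span_X] at hp
  induction hp using Submodule.span_induction with
  | mem x hx => obtain ⟨i, rfl⟩ := hx; simp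
  | zero => simp
  | add p q _ _ hp hq => simp only [map_add, hp, hq]; ring
  | smul c p _ hp => simp only [smul_eval, hp]; ring

/-- The values at (1, 0) and (0, 1) are the coefficients of the two pure powers; every other
monomial of the form is divisible by both variables. -/
lemma mem_span_X_mul_X {n : ℕ} {p : MvPolynomial (Fin 2) ℂ} (hp : p.IsHomogeneous n)
    (h0 : eval ![1, 0] p = 0) (h1 : eval ![0, 1] p = 0) :
    p ∈ Ideal.span {(X 0 * X 1 : MvPolynomial (Fin 2) ℂ)} := by
  have hX : (X 0 * X 1 : MvPolynomial (Fin 2) ℂ)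
      = monomial (Finsupp.single 0 1 + Finsupp.single 1 1) 1 := by
    rw [X, X, monomial_mul, one_mul]
  have hdeg : ∀ d : Fin 2 →₀ ℕ, d.degree = d 0 + d 1 := fun d => by
    rw [Finsupp.degree_eq_sum, Fin.sum_univ_two]
  have hcoef : ∀ d : Fin 2 →₀ ℕ, d ∈ p.support → d 0 ≠ 0 ∧ d 1 ≠ 0 := by
    intro d hd
    have hsum : ∀ e ∈ p.support, e 0 + e 1 = n := fun e he => by
      have := hp.degree_eq_sum_deg_support he
      rw [← Finsupp.degree_apply, hdeg] at this
      exact this.symm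
    have hdn := hsum d hd
    rw [mem_support_iff] at hd
    constructor
    · intro hd0
      rw [eval_eq', Finset.sum_eq_single d] at h1
      · simp [Fin.prod_univ_two, hd0, hd] at h1
      · intro e he hne
        have : e 0 ≠ 0 := fun he0 => hne (by
          have := hsum e he
          ext j
          fin_cases j <;> simp <;> omega)
        simp [Fin.prod_univ_two, this]
      · intro h; exact absurd (mem_support_iff.mpr hd) h
    · intro hd1
      rw [eval_eq', Finset.sum_eq_single d] at h0
      · simp [Fin.prod_univ_two, hd1, hd] at h0
      · intro e he hne
        have : e 1 ≠ 0 := fun he0 => hne (by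
          have := hsum e he
          ext j
          fin_cases j <;> simp <;> omega)
        simp [Fin.prod_univ_two, this]
      · intro h; exact absurd (mem_support_iff.mpr hd) h
  have hset : ({(X 0 * X 1 : MvPolynomial (Fin 2) ℂ)} : Set (MvPolynomial (Fin 2) ℂ))
      = (fun s => monomial s (1 : ℂ)) '' {Finsupp.single 0 1 + Finsupp.single 1 1} := by
    rw [Set.image_singleton, hX]
  rw [hset, mem_ideal_span_monomial_image]
  intro d hd
  refine ⟨_, rfl, ?_⟩
  obtain ⟨h0, h1⟩ := hcoef d hd
  rw [Finsupp.le_def, Fin.forall_fin_two]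
  simp
  omega

/-- The linear form on affine space attached to a linear functional. -/
def formOf [Fintype σ] [DecidableEq σ] (φ : (σ → ℂ) →ₗ[ℂ] ℂ) : MvPolynomial σ ℂ :=
  ∑ k, C (φ (Pi.single k 1)) * X k

lemma functional_eq_sum [Fintype σ] [DecidableEq σ] (φ : (σ → ℂ) →ₗ[ℂ] ℂ) (y : σ → ℂ) :
    φ y = ∑ k, φ (Pi.single k 1) * y k := by
  conv_lhs => rw [pi_eq_sum_univ' y]
  simp [mul_comm]

lemma eval_formOf [Fintype σ] [DecidableEq σ] (φ : (σ → ℂ) →ₗ[ℂ] ℂ) (y : σ → ℂ) :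
    eval y (formOf φ) = φ y := by
  rw [functional_eq_sum φ y]
  simp [formOf]

/-- A polynomial is congruent to its restriction to a linear subspace modulo the equations of the
subspace. -/
lemma sub_aeval_mem [Fintype σ] [DecidableEq σ] {J : Ideal (MvPolynomial σ ℂ)}
    {Λ : (σ → ℂ) →ₗ[ℂ] (Fin 4 → ℂ)} {s : (Fin 4 → ℂ) →ₗ[ℂ] (σ → ℂ)} {Y : Fin 2 → σ → ℂ}
    {μ : Fin 2 → (σ → ℂ) →ₗ[ℂ] ℂ} (hdec : ∀ y, y = s (Λ y) + μ 0 y • Y 0 + μ 1 y • Y 1)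
    (hJ : ∀ i, formOf ((LinearMap.proj i).comp Λ) ∈ J) (p : MvPolynomial σ ℂ) :
    p - aeval (fun k => C (Y 0 k) * formOf (μ 0) + C (Y 1 k) * formOf (μ 1)) p ∈ J := by
  have hX : ∀ k, X k - (C (Y 0 k) * formOf (μ 0) + C (Y 1 k) * formOf (μ 1)) ∈ J := by
    intro k
    have : X k - (C (Y 0 k) * formOf (μ 0) + C (Y 1 k) * formOf (μ 1))
        = ∑ i, C (s (Pi.single i 1) k) * formOf ((LinearMap.proj i).comp Λ) := by
      refine MvPolynomial.funext fun y => ?_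
      have h1 : s (Λ y) k = ∑ i, s (Pi.single i 1) k * Λ y i :=
        functional_eq_sum ((LinearMap.proj k).comp s) (Λ y)
      have h2 := congrFun (hdec y) k
      simp only [Pi.add_apply, Pi.smul_apply, smul_eq_mul, h1] at h2
      simp only [map_sub, map_add, map_mul, map_sum, eval_X, eval_C, eval_formOf,
        LinearMap.comp_apply, LinearMap.proj_apply]
      rw [h2]; ring
    rw [this]
    exact Ideal.sum_mem _ fun i _ => Ideal.mul_mem_left _ _ (hJ i)
  rw [← Ideal.Quotient.eq]
  have h1 : (Ideal.Quotient.mkₐ ℂ J) = (Ideal.Quotient.mkₐ ℂ J).comp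
      (aeval fun k => C (Y 0 k) * formOf (μ 0) + C (Y 1 k) * formOf (μ 1)) := by
    ext k
    simp only [AlgHom.comp_apply, aeval_X]
    exact Ideal.Quotient.eq.mpr (hX k)
  exact congrArg (fun φ : MvPolynomial σ ℂ →ₐ[ℂ] _ => φ p) h1

lemma eval_aeval {τ : Type*} (f : σ → MvPolynomial τ ℂ) (y : τ → ℂ) (p : MvPolynomial σ ℂ) :
    eval y (aeval f p) = eval (fun k => eval y (f k)) p := by
  induction p using MvPolynomial.induction_on with
  | C c => simp
  | add p q hp hq => simp only [map_add, hp, hq]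
  | mul_X p k hp => simp only [map_mul, hp, aeval_X, eval_X]

lemma eval_aeval_two (Y : Fin 2 → σ → ℂ) {τ : Type*} (M : Fin 2 → MvPolynomial τ ℂ)
    (p : MvPolynomial σ ℂ) (y : τ → ℂ) :
    eval y (aeval (fun k => C (Y 0 k) * M 0 + C (Y 1 k) * M 1) p)
      = eval (eval y (M 0) • Y 0 + eval y (M 1) • Y 1) p := by
  rw [eval_aeval]
  congr 2
  funext k
  simp only [map_add, map_mul, eval_C, Pi.add_apply, Pi.smul_apply, smul_eq_mul]
  ring

lemma taylorForm_eq_formOf [Fintype σ] [DecidableEq σ] {a : σ → ℂ} {G : Fin 4 → MvPolynomial σ ℂ}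
    {Λ : (σ → ℂ) →ₗ[ℂ] (Fin 4 → ℂ)} (hΛ : ∀ y i, eval y (taylorForm a 1 (G i)) = Λ y i)
    (i : Fin 4) : taylorForm a 1 (G i) = formOf ((LinearMap.proj i).comp Λ) :=
  MvPolynomial.funext fun y => by rw [hΛ, eval_formOf]; rfl

variable [Fintype σ]

section

variable {I : Ideal (MvPolynomial σ ℂ)} {a : σ → ℂ} {G : Fin 4 → MvPolynomial σ ℂ}
  {g : MvPolynomial σ ℂ} (hGI : ∀ i, G i ∈ I) (hgI : g ∈ I)
  (hI : ∀ f ∈ I, ∀ x, (∀ i, eval x (G i) = 0) → eval x g = 0 → eval x f = 0)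
  (hGa : ∀ i, G i ∈ maxIdeal a)
  {Λ : (σ → ℂ) →ₗ[ℂ] (Fin 4 → ℂ)} (hΛ : ∀ y i, eval y (taylorForm a 1 (G i)) = Λ y i)
  {s : (Fin 4 → ℂ) →ₗ[ℂ] (σ → ℂ)} (hs : ∀ z, Λ (s z) = z)
  {Y : Fin 2 → σ → ℂ} (hY : ∀ j, Λ (Y j) = 0)
  {μ : Fin 2 → (σ → ℂ) →ₗ[ℂ] ℂ} (hdec : ∀ y, y = s (Λ y) + μ 0 y • Y 0 + μ 1 y • Y 1)
include hGI hgI hI hGa hΛ hs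

/-- Generic construction of branches: `g` is an element of order at least `r`, and the points of `Z`
are smooth points of the projective scheme defined by the leading forms. -/
lemma localBranches_aux {r : ℕ} (hg : g ∈ maxIdeal a ^ r) {m : ℕ} {Z : Fin m → σ → ℂ}
    (hZ : ∀ j, Λ (Z j) = 0 ∧ eval (Z j) (taylorForm a r g) = 0 ∧
      ∃ v, Λ v = 0 ∧ eval v (taylorForm (Z j) 1 (taylorForm a r g)) ≠ 0)
    (hspan : ∀ J : Ideal (MvPolynomial σ ℂ), (∀ i, taylorForm a 1 (G i) ∈ J) →
      taylorForm a r g ∈ J → ∀ (n : ℕ) (p : MvPolynomial σ ℂ), p.IsHomogeneous n →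
      (∀ j, eval (Z j) p = 0) → p ∈ J) : LocalBranches I a Z := by
  -- `none` stands for the fifth equation, of order `r`, and `some i` for the four equations of
  -- order one.
  let H : Option (Fin 4) → MvPolynomial σ ℂ := fun o => o.elim g G
  let ρ : Option (Fin 4) → ℕ := fun o => o.elim r fun _ => 1
  have hH : ∀ o, H o ∈ maxIdeal a ^ ρ o := by
    rintro (_ | i)
    · exact hg
    · simpa [H, ρ] using hGa i
  constructor
  · intro n f hf hfZ
    obtain ⟨i, hi, hfi⟩ := exists_sub_mem_maxIdeal_pow hH hf
      (hspan _ (fun i => Ideal.subset_span (Set.mem_range_self (some i)))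
        (Ideal.subset_span (Set.mem_range_self none)) n _ (taylorForm_isHomogeneous a n f) hfZ)
    refine ⟨i, ?_, hfi⟩
    refine Ideal.span_le.mpr ?_ hi
    rintro _ ⟨_ | i, rfl⟩
    · exact hgI
    · exact hGI i
  · intro n f hf hfI j
    obtain ⟨hj1, hj2, v, hv, hvg⟩ := hZ j
    refine eval_taylorForm_eq_zero hH ?_ ?_ hf ?_
    · rintro (_ | i)
      · exact hj2
      · simp only [H, ρ, Option.elim, hΛ, hj1, Pi.zero_apply]
    · intro z
      have hD : ∀ w, HasDerivAt (fun t : ℂ => eval (Z j + t • w) (taylorForm a r g))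
          (eval w (taylorForm (Z j) 1 (taylorForm a r g))) 0 := by
        intro w
        simp only [← eval_toLine]
        have := (toLine (Z j) w (taylorForm a r g)).hasDerivAt 0
        rwa [← Polynomial.coeff_zero_eq_eval_zero, Polynomial.coeff_derivative, coeff_toLine,
          Nat.cast_zero, zero_add, zero_add, mul_one] at this
      have hlin := taylorForm_isHomogeneous (Z j) 1 (taylorForm a r g)
      -- The section `s` meets the four linear conditions. Adding a multiple of `v`, which lies in
      -- the kernel of `Λ`, then adjusts the remaining condition without disturbing them.
      let w₀ := s fun i => z (some i)
      let c := (z none - eval w₀ (taylorForm (Z j) 1 (taylorForm a r g))) /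
        eval v (taylorForm (Z j) 1 (taylorForm a r g))
      refine ⟨w₀ + c • v, ?_⟩
      rintro (_ | i)
      · have hz : z none = eval (w₀ + c • v) (taylorForm (Z j) 1 (taylorForm a r g)) := by
          rw [eval_add_of_isHomogeneous_one hlin, eval_smul_of_isHomogeneous hlin]
          simp only [c]
          field_simp
          ring
        rw [hz]
        exact hD (w₀ + c • v)
      · simp only [H, ρ, Option.elim, hΛ, map_add, map_smul, hv, hj1, smul_zero, add_zero,
          zero_add, w₀, hs, Pi.smul_apply, smul_eq_mul]
        simpa using (hasDerivAt_id (0 : ℂ)).mul_const (z (some i))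
    · intro x hx
      obtain ⟨k, hk⟩ := hfI
      have := hI _ hk x (fun i => hx (some i)) (hx none)
      rw [map_pow] at this
      exact eq_zero_of_pow_eq_zero this

include hY hdec

/-- The branch at a point where the five differentials are linearly independent. -/
lemma localBranches_of_linear (hg : g ∈ maxIdeal a)
    (h0 : eval (Y 0) (taylorForm a 1 g) = 0) (h1 : eval (Y 1) (taylorForm a 1 g) ≠ 0) :
    LocalBranches I a ![Y 0] := by
  classical
  have hlin := taylorForm_isHomogeneous a 1 g
  refine localBranches_aux hGI hgI hI hGa hΛ hs (r := 1) (by rwa [pow_one]) ?_ ?_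
  · intro j
    rw [Subsingleton.elim j 0]
    refine ⟨hY 0, h0, Y 1, hY 1, ?_⟩
    rw [Matrix.cons_val_zero, taylorForm_eval_eq_coeff (Y 0) (Y 1) _
      (Polynomial.C (eval (Y 1) (taylorForm a 1 g)) * Polynomial.X)]
    · simpa using h1
    · intro t
      rw [eval_add_of_isHomogeneous_one hlin, eval_smul_of_isHomogeneous hlin, h0,
        Polynomial.eval_mul, Polynomial.eval_C, Polynomial.eval_X]
      ring
  · intro J hJG hJg n p hp hpZ
    have hJ : ∀ i, formOf ((LinearMap.proj i).comp Λ) ∈ J := fun i => by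
      rw [← taylorForm_eq_formOf hΛ]; exact hJG i
    -- Modulo the forms of `Λ`, the linear part of `g` is a multiple of `μ 1` alone, because it
    -- vanishes on `Y 0`.
    have hM : formOf (μ 1) ∈ J := by
      have h2 := sub_aeval_mem hdec hJ (taylorForm a 1 g)
      have h3 : aeval (fun k => C (Y 0 k) * formOf (μ 0) + C (Y 1 k) * formOf (μ 1))
          (taylorForm a 1 g) = C (eval (Y 1) (taylorForm a 1 g)) * formOf (μ 1) := by
        refine MvPolynomial.funext fun y => ?_
        rw [eval_aeval_two Y fun j => formOf (μ j), eval_add_of_isHomogeneous_one hlin,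
          eval_smul_of_isHomogeneous hlin, eval_smul_of_isHomogeneous hlin, h0, map_mul, eval_C]
        ring
      rw [h3] at h2
      have h4 := (Submodule.sub_mem_iff_right J hJg).mp h2
      have h5 := J.mul_mem_left (C (eval (Y 1) (taylorForm a 1 g))⁻¹) h4
      rwa [← mul_assoc, ← C_mul, inv_mul_cancel₀ h1, C_1, one_mul] at h5
    have h2 := sub_aeval_mem hdec hJ p
    have h3 : aeval (fun k => C (Y 0 k) * formOf (μ 0) + C (Y 1 k) * formOf (μ 1)) p ∈ J := by
      have h4 : aeval (fun k => C (Y 0 k) * formOf (μ 0) + C (Y 1 k) * formOf (μ 1)) p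
          - aeval (fun k => C (Y 0 k) * formOf (μ 0)) p ∈ J := by
        rw [← Ideal.Quotient.eq]
        have h5 : (Ideal.Quotient.mkₐ ℂ J).comp
            (aeval fun k => C (Y 0 k) * formOf (μ 0) + C (Y 1 k) * formOf (μ 1))
            = (Ideal.Quotient.mkₐ ℂ J).comp (aeval fun k => C (Y 0 k) * formOf (μ 0)) := by
          ext k
          simp only [AlgHom.comp_apply, aeval_X]
          refine Ideal.Quotient.eq.mpr ?_
          rw [add_sub_cancel_left]
          exact J.mul_mem_left _ hM
        exact congrArg (fun φ : MvPolynomial σ ℂ →ₐ[ℂ] _ => φ p) h5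
      have h6 : aeval (fun k => C (Y 0 k) * formOf (μ 0)) p = 0 := by
        refine MvPolynomial.funext fun y => ?_
        have h7 : (fun k => eval y (C (Y 0 k) * formOf (μ 0))) = eval y (formOf (μ 0)) • Y 0 := by
          funext k
          simp only [map_mul, eval_C, Pi.smul_apply, smul_eq_mul]
          ring
        have h8 := hpZ 0
        rw [Matrix.cons_val_zero] at h8
        rw [eval_aeval, h7, eval_smul_of_isHomogeneous hp, h8, mul_zero, map_zero]
      rwa [h6, sub_zero] at h4
    simpa using J.add_mem h2 h3

/-- The branches at a point where the linear parts of the first four equations are independent, and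
the fifth equation defines a nondegenerate quadratic cone on their kernel. -/
lemma localBranches_of_quadratic (hg : g ∈ maxIdeal a ^ 2) {B : ℂ} (hB : B ≠ 0)
    (hq : ∀ u v : ℂ, eval (u • Y 0 + v • Y 1) (taylorForm a 2 g) = u * v * B) :
    LocalBranches I a Y := by
  classical
  refine localBranches_aux hGI hgI hI hGa hΛ hs hg ?_ ?_
  · have hder : ∀ y w : σ → ℂ, (∀ t : ℂ, eval (y + t • w) (taylorForm a 2 g) = t * B) →
        eval w (taylorForm y 1 (taylorForm a 2 g)) ≠ 0 := by
      intro y w h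
      rw [taylorForm_eval_eq_coeff y w _ (Polynomial.C B * Polynomial.X)]
      · simpa using hB
      · intro t; rw [h, Polynomial.eval_mul, Polynomial.eval_C, Polynomial.eval_X, mul_comm]
    have e0 := hq 1 0
    have e1 := hq 0 1
    simp only [one_smul, zero_smul, add_zero, zero_add, mul_zero, zero_mul] at e0 e1
    rw [Fin.forall_fin_two]
    refine ⟨⟨hY 0, e0, Y 1, hY 1, hder _ _ fun t => ?_⟩, ⟨hY 1, e1, Y 0, hY 0, hder _ _ fun t => ?_⟩⟩
    · simpa using hq 1 t
    · simpa [add_comm] using hq t 1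
  · intro J hJG hJg n p hp hpZ
    have hJ : ∀ i, formOf ((LinearMap.proj i).comp Λ) ∈ J := fun i => by
      rw [← taylorForm_eq_formOf hΛ]; exact hJG i
    have hM : formOf (μ 0) * formOf (μ 1) ∈ J := by
      have h2 := sub_aeval_mem hdec hJ (taylorForm a 2 g)
      have h3 : aeval (fun k => C (Y 0 k) * formOf (μ 0) + C (Y 1 k) * formOf (μ 1))
          (taylorForm a 2 g) = C B * (formOf (μ 0) * formOf (μ 1)) := by
        refine MvPolynomial.funext fun y => ?_
        rw [eval_aeval_two Y fun j => formOf (μ j), hq, map_mul, map_mul, eval_C]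
        ring
      rw [h3] at h2
      have h4 := (Submodule.sub_mem_iff_right J hJg).mp h2
      have h5 := J.mul_mem_left (C B⁻¹) h4
      rwa [← mul_assoc, ← C_mul, inv_mul_cancel₀ hB, C_1, one_mul] at h5
    have h2 := sub_aeval_mem hdec hJ p
    have h3 : aeval (fun k => C (Y 0 k) * formOf (μ 0) + C (Y 1 k) * formOf (μ 1)) p ∈ J := by
      -- Restriction to the plane of the `Y j` factors through binary forms, where the ideal of the
      -- two coordinate lines is generated by the product of the variables.
      let ψ : MvPolynomial (Fin 2) ℂ →ₐ[ℂ] MvPolynomial σ ℂ := aeval fun j => formOf (μ j)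
      let q : MvPolynomial (Fin 2) ℂ := aeval (fun k => C (Y 0 k) * X 0 + C (Y 1 k) * X 1) p
      have hψ : aeval (fun k => C (Y 0 k) * formOf (μ 0) + C (Y 1 k) * formOf (μ 1)) p = ψ q := by
        refine MvPolynomial.funext fun y => ?_
        simp only [ψ, q]
        rw [eval_aeval_two Y fun j => formOf (μ j), eval_aeval, eval_aeval_two Y X]
        simp only [eval_X]
      have hqh : q.IsHomogeneous n := by
        have := hp.aeval (fun k => C (Y 0 k) * X 0 + C (Y 1 k) * X 1)
          (fun k => (isHomogeneous_C_mul_X (Y 0 k) (0 : Fin 2)).add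
            (isHomogeneous_C_mul_X (Y 1 k) (1 : Fin 2)))
        rwa [one_mul] at this
      have hqe : ∀ y, eval y q = eval (y 0 • Y 0 + y 1 • Y 1) p := by
        intro y
        rw [eval_aeval_two Y X]
        simp only [eval_X]
      have hmem := Ideal.mem_map_of_mem ψ (mem_span_X_mul_X hqh (by simpa [hqe] using hpZ 0)
        (by simpa [hqe] using hpZ 1))
      rw [hψ]
      refine Ideal.map_le_iff_le_comap.mpr ?_ hmem
      rw [Ideal.span_singleton_le_iff_mem, Ideal.mem_comap]
      simpa [ψ] using hM
    simpa using J.add_mem h2 h3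

end

end Frame

/-! ### Polarization of the cubic form -/

section Polarization

variable {F : MvPolynomial (Fin 5) ℂ}

/-- The coefficients of the polarization of a cubic form. -/
def polarCoeff (F : MvPolynomial (Fin 5) ℂ) (i j k : Fin 5) : ℂ :=
  6⁻¹ * eval 0 (pderiv i (pderiv j (pderiv k F)))

/-- The commutator of two derivations is a derivation, and this one kills the variables. -/
lemma pderiv_pderiv_comm {σ : Type*} (i j : σ) (p : MvPolynomial σ ℂ) :
    pderiv i (pderiv j p) = pderiv j (pderiv i p) := by
  classical
  have h : ⁅pderiv (R := ℂ) i, pderiv (R := ℂ) j⁆ = 0 := by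
    refine derivation_ext fun k => ?_
    rw [Derivation.commutator_apply, pderiv_X, pderiv_X, Pi.single_apply, Pi.single_apply]
    split_ifs <;> simp
  have h' := congrArg (fun D : Derivation ℂ (MvPolynomial σ ℂ) (MvPolynomial σ ℂ) => D p) h
  simp only [Derivation.commutator_apply, Derivation.coe_zero, Pi.zero_apply] at h'
  exact sub_eq_zero.mp h'

/-- The symmetric trilinear form of a cubic form. -/
def polar (F : MvPolynomial (Fin 5) ℂ) :
    (Fin 5 → ℂ) →ₗ[ℂ] (Fin 5 → ℂ) →ₗ[ℂ] (Fin 5 → ℂ) →ₗ[ℂ] ℂ :=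
  ∑ i, ∑ j, ∑ k, polarCoeff F i j k • (LinearMap.proj i : (Fin 5 → ℂ) →ₗ[ℂ] ℂ).smulRight
    ((LinearMap.proj j : (Fin 5 → ℂ) →ₗ[ℂ] ℂ).smulRight
      (LinearMap.proj k : (Fin 5 → ℂ) →ₗ[ℂ] ℂ))

lemma polar_apply (x y z : Fin 5 → ℂ) :
    polar F x y z = ∑ i, ∑ j, ∑ k, polarCoeff F i j k * (x i * (y j * z k)) := by
  simp only [polar, LinearMap.sum_apply, LinearMap.smul_apply, LinearMap.smulRight_apply,
    LinearMap.proj_apply, smul_eq_mul]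

lemma polar_swap (x y z : Fin 5 → ℂ) : polar F x y z = polar F y x z := by
  rw [polar_apply, polar_apply, Finset.sum_comm]
  refine Finset.sum_congr rfl fun i _ => Finset.sum_congr rfl fun j _ =>
    Finset.sum_congr rfl fun k _ => ?_
  rw [polarCoeff, polarCoeff, pderiv_pderiv_comm]
  ring

lemma polar_swap_right (x y z : Fin 5 → ℂ) : polar F x y z = polar F x z y := by
  rw [polar_apply, polar_apply]
  refine Finset.sum_congr rfl fun i _ => ?_
  rw [Finset.sum_comm]
  refine Finset.sum_congr rfl fun j _ => Finset.sum_congr rfl fun k _ => ?_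
  rw [polarCoeff, polarCoeff, pderiv_pderiv_comm k j]
  ring

lemma polar_rotate (x y z : Fin 5 → ℂ) : polar F x y z = polar F y z x := by
  rw [polar_swap, polar_swap_right]

lemma sum_mul_eval_pderiv {n : ℕ} {G : MvPolynomial (Fin 5) ℂ} (hG : G.IsHomogeneous n)
    (x : Fin 5 → ℂ) : ∑ i, x i * eval x (pderiv i G) = n * eval x G := by
  have := congrArg (eval x) hG.sum_X_mul_pderiv
  simpa using this

/-- Euler's identity is applied to the first and then to the second partials; the third partials are
constants, so evaluating them at 0 loses nothing. -/
lemma eval_pderiv (hF : F.IsHomogeneous 3) (x : Fin 5 → ℂ) (k : Fin 5) :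
    eval x (pderiv k F) = 3 * polar F x x (Pi.single k 1) := by
  have h1 : (pderiv k F).IsHomogeneous 2 := hF.pderiv
  have h2 : ∀ j, (pderiv j (pderiv k F)).IsHomogeneous 1 := fun j => h1.pderiv
  have h3 : ∀ i j, (pderiv i (pderiv j (pderiv k F))).IsHomogeneous 0 := fun i j => (h2 j).pderiv
  have h4 : ∀ i j, eval x (pderiv i (pderiv j (pderiv k F))) = 6 * polarCoeff F i j k := by
    intro i j
    have := eval_smul_of_isHomogeneous (h3 i j) 0 x
    rw [zero_smul, pow_zero, one_mul] at this
    rw [polarCoeff, this]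
    ring
  have h5 := sum_mul_eval_pderiv h1 x
  have h6 : ∀ j, eval x (pderiv j (pderiv k F)) = ∑ i, x i * (6 * polarCoeff F i j k) := by
    intro j
    have := sum_mul_eval_pderiv (h2 j) x
    simp only [h4, Nat.cast_one, one_mul] at this
    exact this.symm
  have h7 : polar F x x (Pi.single k 1) = ∑ j, ∑ i, polarCoeff F i j k * (x i * x j) := by
    rw [polar_apply, Finset.sum_comm]
    refine Finset.sum_congr rfl fun j _ => Finset.sum_congr rfl fun i _ => ?_
    rw [Finset.sum_eq_single k]
    · simp
    · intro l _ hl; simp [Pi.single_eq_of_ne hl]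
    · simp
  have h8 : (2 : ℂ) * eval x (pderiv k F) = 6 * polar F x x (Pi.single k 1) := by
    rw [h7, Finset.mul_sum]
    refine h5.symm.trans (Finset.sum_congr rfl fun j _ => ?_)
    rw [h6, Finset.mul_sum, Finset.mul_sum]
    exact Finset.sum_congr rfl fun i _ => by ring
  linear_combination h8 / 2

lemma eval_eq_polar (hF : F.IsHomogeneous 3) (x : Fin 5 → ℂ) : eval x F = polar F x x x := by
  have h := sum_mul_eval_pderiv hF x
  simp only [eval_pderiv hF] at h
  have h2 := functional_eq_sum (polar F x x) x
  have h3 : ∑ i, x i * (3 * polar F x x (Pi.single i 1)) = 3 * polar F x x x := by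
    rw [h2, Finset.mul_sum]
    exact Finset.sum_congr rfl fun i _ => by ring
  rw [h3] at h
  push_cast at h
  linear_combination -h / 3

end Polarization

/-! ### The equations of the curve in a chart, in polarized form -/

section Chart

variable (e : Fin 2 ⊕ Fin 3 ≃ Fin 5)

/-- The spanning vectors of the line with coordinates `a`. -/
def vec (a : Fin 2 × Fin 3 → ℂ) (u : Fin 2) (i : Fin 5) : ℂ := eval a (chartVec e u i)

lemma vec_inl (a : Fin 2 × Fin 3 → ℂ) (u u' : Fin 2) :
    vec e a u (e (Sum.inl u')) = if u' = u then 1 else 0 := by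
  simp only [vec, chartVec, Equiv.symm_apply_apply, Sum.elim_inl]
  split_ifs <;> simp

lemma vec_inr (a : Fin 2 × Fin 3 → ℂ) (u : Fin 2) (k : Fin 3) :
    vec e a u (e (Sum.inr k)) = a (u, k) := by
  simp [vec, chartVec]

/-- The vector with the coordinates `c` in the complementary directions of the chart. -/
def complVec : (Fin 3 → ℂ) →ₗ[ℂ] (Fin 5 → ℂ) :=
  ∑ k, (LinearMap.proj k : (Fin 3 → ℂ) →ₗ[ℂ] ℂ).smulRight (Pi.single (e (Sum.inr k)) 1)

lemma complVec_apply (c : Fin 3 → ℂ) :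
    complVec e c = ∑ k, c k • (Pi.single (e (Sum.inr k)) 1 : Fin 5 → ℂ) := by
  simp [complVec]

lemma complVec_inl (c : Fin 3 → ℂ) (u : Fin 2) : complVec e c (e (Sum.inl u)) = 0 := by
  rw [complVec_apply, Finset.sum_apply]
  refine Finset.sum_eq_zero fun k _ => ?_
  simp

lemma complVec_inr (c : Fin 3 → ℂ) (k : Fin 3) : complVec e c (e (Sum.inr k)) = c k := by
  rw [complVec_apply, Finset.sum_apply, Finset.sum_eq_single k]
  · simp
  · intro l _ hl; simp [Ne.symm hl]
  · simp

lemma ext_chart {x y : Fin 5 → ℂ} (hl : ∀ u, x (e (Sum.inl u)) = y (e (Sum.inl u)))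
    (hr : ∀ k, x (e (Sum.inr k)) = y (e (Sum.inr k))) : x = y := by
  funext i
  obtain ⟨j, rfl⟩ := e.surjective i
  rcases j with u | k
  exacts [hl u, hr k]

lemma vec_add_smul (a y : Fin 2 × Fin 3 → ℂ) (t : ℂ) (u : Fin 2) :
    vec e (a + t • y) u = vec e a u + t • complVec e fun k => y (u, k) := by
  refine ext_chart e (fun u' => ?_) fun k => ?_
  · simp [vec_inl, complVec_inl]
  · simp [vec_inr, complVec_inr]

lemma eq_vec_add_complVec (a : Fin 2 × Fin 3 → ℂ) (x : Fin 5 → ℂ) :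
    x = x (e (Sum.inl 0)) • vec e a 0 + x (e (Sum.inl 1)) • vec e a 1 +
      complVec e fun k => x (e (Sum.inr k)) - x (e (Sum.inl 0)) * a (0, k)
        - x (e (Sum.inl 1)) * a (1, k) := by
  refine ext_chart e (fun u => ?_) fun k => ?_
  · fin_cases u <;> simp [vec_inl, complVec_inl]
  · simp only [Pi.add_apply, Pi.smul_apply, smul_eq_mul, vec_inr, complVec_inr]
    ring

lemma chartLine_eq_span (a : Fin 2 × Fin 3 → ℂ) :
    chartLine e a = Submodule.span ℂ {vec e a 0, vec e a 1} := by
  rw [chartLine]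
  congr 1
  ext x
  constructor
  · rintro ⟨u, rfl⟩
    fin_cases u
    · exact Or.inl rfl
    · exact Or.inr rfl
  · rintro (rfl | rfl)
    exacts [⟨0, rfl⟩, ⟨1, rfl⟩]

variable {e}

/-- Coefficients along the line can be read off from any binary polynomial with the right values.
Leaving `p` arbitrary lets later lemmas supply an explicit expansion. -/
lemma eval_lineCoeff {G : MvPolynomial (Fin 5) ℂ} {a : Fin 2 × Fin 3 → ℂ}
    {p : MvPolynomial (Fin 2) ℂ}
    (hp : ∀ t : Fin 2 → ℂ, eval t p = eval (t 0 • vec e a 0 + t 1 • vec e a 1) G) (i j : ℕ) :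
    eval a (lineCoeff e G i j) = coeff (Finsupp.single 0 i + Finsupp.single 1 j) p := by
  rw [lineCoeff, ← coeff_map]
  congr 1
  refine MvPolynomial.funext fun t => ?_
  rw [hp]
  induction G using MvPolynomial.induction_on generalizing p with
  | C c => simp [MvPolynomial.algebraMap_eq, MvPolynomial.algebraMap_apply]
  | add G H hG hH =>
    simp only [map_add]
    rw [hG (p := aeval (fun k => X 0 * C (vec e a 0 k) + X 1 * C (vec e a 1 k)) G),
      hH (p := aeval (fun k => X 0 * C (vec e a 0 k) + X 1 * C (vec e a 1 k)) H)]
    all_goals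
      intro t
      rw [eval_aeval]
      congr 2
      funext k
      simp
  | mul_X G k hG =>
    simp only [map_mul]
    rw [hG (p := aeval (fun k => X 0 * C (vec e a 0 k) + X 1 * C (vec e a 1 k)) G)]
    · congr 1
      simp [Fin.sum_univ_two, vec]
    · intro t
      rw [eval_aeval]
      congr 2
      funext k
      simp

lemma single_add_single_eq_iff {i j i' j' : ℕ} :
    (Finsupp.single (0 : Fin 2) i + Finsupp.single (1 : Fin 2) j
      = Finsupp.single (0 : Fin 2) i' + Finsupp.single (1 : Fin 2) j') ↔ i = i' ∧ j = j' := by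
  constructor
  · intro h
    have h0 := DFunLike.congr_fun h 0
    have h1 := DFunLike.congr_fun h 1
    simpa using And.intro h0 h1
  · rintro ⟨rfl, rfl⟩; rfl

lemma eval_monomial_two (t : Fin 2 → ℂ) (i j : ℕ) (c : ℂ) :
    eval t (monomial (Finsupp.single (0 : Fin 2) i + Finsupp.single (1 : Fin 2) j) c)
      = c * (t 0 ^ i * t 1 ^ j) := by
  rw [eval_monomial, Finsupp.prod_add_index' (by simp) (fun _ _ _ => pow_add _ _ _)]
  simp

variable {F : MvPolynomial (Fin 5) ℂ} (hF : F.IsHomogeneous 3) (a : Fin 2 × Fin 3 → ℂ)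
include hF

lemma eval_lineCoeff_cubic :
    eval a (lineCoeff e F 3 0) = polar F (vec e a 0) (vec e a 0) (vec e a 0) ∧
    eval a (lineCoeff e F 2 1) = 3 * polar F (vec e a 0) (vec e a 0) (vec e a 1) ∧
    eval a (lineCoeff e F 1 2) = 3 * polar F (vec e a 0) (vec e a 1) (vec e a 1) ∧
    eval a (lineCoeff e F 0 3) = polar F (vec e a 1) (vec e a 1) (vec e a 1) := by
  have hp : ∀ t : Fin 2 → ℂ, eval t
      (monomial (Finsupp.single (0 : Fin 2) 3 + Finsupp.single (1 : Fin 2) 0)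
          (polar F (vec e a 0) (vec e a 0) (vec e a 0)) +
        monomial (Finsupp.single (0 : Fin 2) 2 + Finsupp.single (1 : Fin 2) 1)
          (3 * polar F (vec e a 0) (vec e a 0) (vec e a 1)) +
        monomial (Finsupp.single (0 : Fin 2) 1 + Finsupp.single (1 : Fin 2) 2)
          (3 * polar F (vec e a 0) (vec e a 1) (vec e a 1)) +
        monomial (Finsupp.single (0 : Fin 2) 0 + Finsupp.single (1 : Fin 2) 3)
          (polar F (vec e a 1) (vec e a 1) (vec e a 1)))
      = eval (t 0 • vec e a 0 + t 1 • vec e a 1) F := by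
    intro t
    rw [eval_eq_polar hF]
    simp only [map_add, eval_monomial_two, LinearMap.add_apply, map_smul, LinearMap.smul_apply,
      smul_eq_mul]
    rw [polar_rotate (vec e a 1) (vec e a 0) (vec e a 0),
      polar_swap_right (vec e a 0) (vec e a 1) (vec e a 0),
      polar_swap (vec e a 1) (vec e a 0) (vec e a 1),
      polar_rotate (vec e a 1) (vec e a 1) (vec e a 0),
      polar_swap (vec e a 1) (vec e a 0) (vec e a 1)]
    ring
  refine ⟨?_, ?_, ?_, ?_⟩ <;> rw [eval_lineCoeff hp] <;>
    simp only [coeff_add, coeff_monomial, single_add_single_eq_iff] <;> norm_num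

lemma eval_lineCoeff_pderiv (k : Fin 5) :
    eval a (lineCoeff e (pderiv k F) 2 0) = 3 * polar F (vec e a 0) (vec e a 0) (Pi.single k 1) ∧
    eval a (lineCoeff e (pderiv k F) 1 1) = 6 * polar F (vec e a 0) (vec e a 1) (Pi.single k 1) ∧
    eval a (lineCoeff e (pderiv k F) 0 2)
      = 3 * polar F (vec e a 1) (vec e a 1) (Pi.single k 1) := by
  have hp : ∀ t : Fin 2 → ℂ, eval t
      (monomial (Finsupp.single (0 : Fin 2) 2 + Finsupp.single (1 : Fin 2) 0)
          (3 * polar F (vec e a 0) (vec e a 0) (Pi.single k 1)) +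
        monomial (Finsupp.single (0 : Fin 2) 1 + Finsupp.single (1 : Fin 2) 1)
          (6 * polar F (vec e a 0) (vec e a 1) (Pi.single k 1)) +
        monomial (Finsupp.single (0 : Fin 2) 0 + Finsupp.single (1 : Fin 2) 2)
          (3 * polar F (vec e a 1) (vec e a 1) (Pi.single k 1)))
      = eval (t 0 • vec e a 0 + t 1 • vec e a 1) (pderiv k F) := by
    intro t
    rw [eval_pderiv hF]
    simp only [map_add, eval_monomial_two, LinearMap.add_apply, map_smul, LinearMap.smul_apply,
      smul_eq_mul]
    rw [polar_swap (vec e a 1) (vec e a 0)]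
    ring
  refine ⟨?_, ?_, ?_⟩ <;> rw [eval_lineCoeff hp] <;>
    simp only [coeff_add, coeff_monomial, single_add_single_eq_iff] <;> norm_num

/-- The `3 × 3` matrix of the derivatives along a line, without binomial coefficients. -/
def derivMatrix (e : Fin 2 ⊕ Fin 3 ≃ Fin 5) (F : MvPolynomial (Fin 5) ℂ)
    (a : Fin 2 × Fin 3 → ℂ) : Matrix (Fin 3) (Fin 3) ℂ :=
  Matrix.of fun r k =>
    ![polar F (vec e a 0) (vec e a 0) (Pi.single (e (Sum.inr k)) 1),
      polar F (vec e a 0) (vec e a 1) (Pi.single (e (Sum.inr k)) 1),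
      polar F (vec e a 1) (vec e a 1) (Pi.single (e (Sum.inr k)) 1)] r

/-- The rows carry the factors 3, 6 and 3, with product 54. -/
lemma eval_secondTypeDet : eval a (secondTypeDet e F) = 54 * (derivMatrix e F a).det := by
  rw [secondTypeDet, RingHom.map_det, Matrix.det_fin_three, Matrix.det_fin_three]
  have h := fun k => eval_lineCoeff_pderiv (e := e) hF a k
  simp [derivMatrix, h]
  ring

/-- By symmetry of `polar` the eight index triples reduce to the four Fano equations; the factors 3
and 54 are harmless. -/
lemma memCurve_iff : MemCurve e F a ↔
    (∀ i j k : Fin 2, polar F (vec e a i) (vec e a j) (vec e a k) = 0) ∧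
      (derivMatrix e F a).det = 0 := by
  obtain ⟨h0, h1, h2, h3⟩ := eval_lineCoeff_cubic (e := e) hF a
  have h4 := eval_secondTypeDet (e := e) hF a
  have hmem : MemCurve e F a ↔ curveIdeal e F ≤ RingHom.ker (eval a) := Iff.rfl
  rw [hmem, curveIdeal, Ideal.span_le]
  simp only [Set.insert_subset_iff, Set.singleton_subset_iff, SetLike.mem_coe, RingHom.mem_ker,
    h0, h1, h2, h3, h4]
  simp only [Fin.forall_fin_two, mul_eq_zero, OfNat.ofNat_ne_zero, false_or]
  rw [polar_rotate (vec e a 1) (vec e a 0) (vec e a 0),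
    polar_swap_right (vec e a 0) (vec e a 1) (vec e a 0),
    polar_swap (vec e a 1) (vec e a 0) (vec e a 1),
    polar_rotate (vec e a 1) (vec e a 1) (vec e a 0),
    polar_swap (vec e a 1) (vec e a 0) (vec e a 1)]
  tauto

end Chart

/-! ### Binary quadratic forms and pencils of conics -/

section BinaryQuadratic

lemma exists_sq_eq (z : ℂ) : ∃ w, w ^ 2 = z := IsAlgClosed.exists_pow_nat_eq z two_pos

/-- A binary quadratic form over `ℂ` has a zero. -/
lemma exists_binary_zero (a b c : ℂ) :
    ∃ p q : ℂ, (p ≠ 0 ∨ q ≠ 0) ∧ a * p ^ 2 + 2 * b * (p * q) + c * q ^ 2 = 0 := by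
  by_cases ha : a = 0
  · exact ⟨1, 0, Or.inl one_ne_zero, by simp [ha]⟩
  · obtain ⟨w, hw⟩ := exists_sq_eq (b ^ 2 - a * c)
    refine ⟨w - b, a, Or.inr ha, ?_⟩
    linear_combination a * hw

/-- If two binary quadratic forms have no common zero then their resultant does not vanish. -/
lemma resultant_ne_zero {a₁ b₁ c₁ a₂ b₂ c₂ : ℂ}
    (h : ∀ p q : ℂ, p ≠ 0 ∨ q ≠ 0 → a₁ * p ^ 2 + 2 * b₁ * (p * q) + c₁ * q ^ 2 = 0 →
      a₂ * p ^ 2 + 2 * b₂ * (p * q) + c₂ * q ^ 2 = 0 → False) :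
    (c₁ * a₂ - a₁ * c₂) ^ 2 - 4 * (b₁ * c₂ - b₂ * c₁) * (a₁ * b₂ - a₂ * b₁) ≠ 0 := by
  intro hdisc
  -- The cross product of the coefficient vectors is orthogonal to both of them. When the
  -- discriminant vanishes it has the shape (p², 2pq, q²), and orthogonality says that both forms
  -- vanish at (p, q).
  obtain ⟨p, hp⟩ := exists_sq_eq (b₁ * c₂ - b₂ * c₁)
  obtain ⟨q, hq, hpq⟩ : ∃ q, q ^ 2 = a₁ * b₂ - a₂ * b₁ ∧ 2 * p * q = c₁ * a₂ - a₁ * c₂ := by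
    obtain ⟨q, hq⟩ := exists_sq_eq (a₁ * b₂ - a₂ * b₁)
    have h1 : (2 * p * q) ^ 2 = (c₁ * a₂ - a₁ * c₂) ^ 2 := by
      rw [mul_pow, mul_pow, hp, hq]
      linear_combination -hdisc
    rcases sq_eq_sq_iff_eq_or_eq_neg.mp h1 with h2 | h2
    · exact ⟨q, hq, h2⟩
    · exact ⟨-q, by rw [neg_sq, hq], by linear_combination -h2⟩
  by_cases h0 : p ≠ 0 ∨ q ≠ 0
  · refine h p q h0 ?_ ?_
    · linear_combination a₁ * hp + b₁ * hpq + c₁ * hq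
    · linear_combination a₂ * hp + b₂ * hpq + c₂ * hq
  · push Not at h0
    obtain ⟨rfl, rfl⟩ := h0
    -- The cross product is zero, so the two forms are proportional, and a zero of one of them
    -- serves for both.
    have e1 : b₁ * c₂ - b₂ * c₁ = 0 := by rw [← hp]; ring
    have e2 : c₁ * a₂ - a₁ * c₂ = 0 := by rw [← hpq]; ring
    have e3 : a₁ * b₂ - a₂ * b₁ = 0 := by rw [← hq]; ring
    by_cases hz : a₁ = 0 ∧ b₁ = 0 ∧ c₁ = 0
    · obtain ⟨rfl, rfl, rfl⟩ := hz
      obtain ⟨p, q, hpq, hz⟩ := exists_binary_zero a₂ b₂ c₂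
      exact h p q hpq (by ring) hz
    · obtain ⟨p, q, hpq, hz1⟩ := exists_binary_zero a₁ b₁ c₁
      refine h p q hpq hz1 ?_
      by_contra hne
      refine hz ⟨?_, ?_, ?_⟩ <;> refine (mul_eq_zero.mp (?_ : _ * (a₂ * p ^ 2 + 2 * b₂ * (p * q)
        + c₂ * q ^ 2) = 0)).resolve_right hne
      · linear_combination a₂ * hz1 + 2 * (p * q) * e3 - q ^ 2 * e2
      · linear_combination b₂ * hz1 - p ^ 2 * e3 + q ^ 2 * e1
      · linear_combination c₂ * hz1 + p ^ 2 * e2 - 2 * (p * q) * e1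

/-- Two coprime binary quadratic forms have no linear syzygies. -/
lemma linear_syzygy_eq_zero {a₁ b₁ c₁ a₂ b₂ c₂ : ℂ}
    (h : (c₁ * a₂ - a₁ * c₂) ^ 2 - 4 * (b₁ * c₂ - b₂ * c₁) * (a₁ * b₂ - a₂ * b₁) ≠ 0)
    {x₀ x₁ y₀ y₁ : ℂ} (h0 : x₀ * a₁ + y₀ * a₂ = 0)
    (h1 : 2 * x₀ * b₁ + x₁ * a₁ + 2 * y₀ * b₂ + y₁ * a₂ = 0)
    (h2 : x₀ * c₁ + 2 * x₁ * b₁ + y₀ * c₂ + 2 * y₁ * b₂ = 0)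
    (h3 : x₁ * c₁ + y₁ * c₂ = 0) : x₀ = 0 ∧ x₁ = 0 ∧ y₀ = 0 ∧ y₁ = 0 := by
  -- The Sylvester matrix of the two forms; its determinant is the resultant.
  let M : Matrix (Fin 4) (Fin 4) ℂ :=
    !![a₁, 0, a₂, 0; 2 * b₁, a₁, 2 * b₂, a₂; c₁, 2 * b₁, c₂, 2 * b₂; 0, c₁, 0, c₂]
  have hM : M.det ≠ 0 := by
    have : M.det = (c₁ * a₂ - a₁ * c₂) ^ 2 -
        4 * (b₁ * c₂ - b₂ * c₁) * (a₁ * b₂ - a₂ * b₁) := by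
      simp [M, Matrix.det_succ_row_zero, Fin.sum_univ_succ, Fin.succAbove]
      ring
    rwa [this]
  have hv := Matrix.eq_zero_of_mulVec_eq_zero hM (v := ![x₀, x₁, y₀, y₁]) (by
    funext i
    fin_cases i <;> simp [M, Matrix.mulVec, dotProduct, Fin.sum_univ_four]
    · linear_combination h0
    · linear_combination h1
    · linear_combination h2
    · linear_combination h3)
  exact ⟨congrFun hv 0, congrFun hv 1, congrFun hv 2, congrFun hv 3⟩

/-- A nondegenerate binary quadratic form over `ℂ` is hyperbolic. -/
lemma exists_isotropic_basis {α β γ : ℂ} (h : β ^ 2 - 4 * α * γ ≠ 0) :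
    ∃ l : Fin 2 → Fin 2 → ℂ, l 0 0 * l 1 1 - l 0 1 * l 1 0 ≠ 0 ∧ ∃ B : ℂ, B ≠ 0 ∧
      ∀ u v : ℂ, α * (u * l 0 0 + v * l 1 0) ^ 2
        + β * ((u * l 0 0 + v * l 1 0) * (u * l 0 1 + v * l 1 1))
        + γ * (u * l 0 1 + v * l 1 1) ^ 2 = u * v * B := by
  by_cases hα : α = 0
  · subst hα
    have hβ : β ≠ 0 := by rintro rfl; simp at h
    refine ⟨![![1, 0], ![-γ, β]], by simpa using hβ, β ^ 2, pow_ne_zero 2 hβ, fun u v => ?_⟩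
    simp
    ring
  · obtain ⟨δ, hδ⟩ := exists_sq_eq (β ^ 2 - 4 * α * γ)
    have hδ0 : δ ≠ 0 := by rintro rfl; apply h; rw [← hδ]; ring
    refine ⟨![![-β + δ, 2 * α], ![-β - δ, 2 * α]], ?_, -4 * α * δ ^ 2, ?_, fun u v => ?_⟩
    · have : (-β + δ) * (2 * α) - 2 * α * (-β - δ) = 4 * α * δ := by ring
      simp only [Matrix.cons_val_zero, Matrix.cons_val_one, this]
      exact mul_ne_zero (mul_ne_zero (by norm_num) hα) hδ0
    · exact mul_ne_zero (mul_ne_zero (by norm_num) hα) (pow_ne_zero 2 hδ0)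
    · simp only [Matrix.cons_val_zero, Matrix.cons_val_one]
      linear_combination (α * (u + v) ^ 2) * hδ

/-- A basis adapted to a nonzero linear functional. -/
lemma exists_adapted_basis {P Q : ℂ} (h : P ≠ 0 ∨ Q ≠ 0) :
    ∃ l : Fin 2 → Fin 2 → ℂ, l 0 0 * l 1 1 - l 0 1 * l 1 0 ≠ 0 ∧
      P * l 0 0 + Q * l 0 1 = 0 ∧ P * l 1 0 + Q * l 1 1 ≠ 0 := by
  by_cases hP : P = 0
  · have hQ : Q ≠ 0 := h.resolve_left (not_not.mpr hP)
    exact ⟨![![1, 0], ![0, 1]], by simp, by simp [hP], by simpa [hP] using hQ⟩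
  · exact ⟨![![-Q, P], ![1, 0]], by simpa using hP, by simp; ring, by simpa using hP⟩

/-- A pencil of ternary quadratic forms has a base point. -/
lemma exists_common_zero (S₁ S₂ : Matrix (Fin 3) (Fin 3) ℂ) (h₁ : S₁.IsSymm) (h₂ : S₂.IsSymm) :
    ∃ z : Fin 3 → ℂ, z ≠ 0 ∧ z ⬝ᵥ S₁.mulVec z = 0 ∧ z ⬝ᵥ S₂.mulVec z = 0 := by
  -- A singular conic is a cone with vertex `z`. Joining `z` to a zero `w` on the coordinate line
  -- missing `z` gives a line inside the conic, and the other form has a zero on that line.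
  have key : ∀ S R : Matrix (Fin 3) (Fin 3) ℂ, S.IsSymm → ∀ z : Fin 3 → ℂ, z ≠ 0 →
      S.mulVec z = 0 → ∃ x : Fin 3 → ℂ, x ≠ 0 ∧ x ⬝ᵥ S.mulVec x = 0 ∧ x ⬝ᵥ R.mulVec x = 0 := by
    intro S R hS z hz hSz
    obtain ⟨i, hi⟩ := Function.ne_iff.mp hz
    obtain ⟨p, q, hpq, hw⟩ := exists_binary_zero (S (i + 1) (i + 1)) (S (i + 1) (i + 2))
      (S (i + 2) (i + 2))
    have hij : i ≠ i + 1 ∧ i ≠ i + 2 ∧ i + 1 ≠ i + 2 := by fin_cases i <;> decide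
    let w : Fin 3 → ℂ := p • Pi.single (i + 1) 1 + q • Pi.single (i + 2) 1
    have hwi : w i = 0 := by simp [w, hij]
    have hw1 : w (i + 1) = p := by simp [w, hij]
    have hw2 : w (i + 2) = q := by simp [w, hij.2.2.symm]
    have hwS : w ⬝ᵥ S.mulVec w = 0 := by
      have hs : S (i + 2) (i + 1) = S (i + 1) (i + 2) := hS.apply _ _
      simp only [w, Matrix.mulVec_add, Matrix.mulVec_smul, add_dotProduct, dotProduct_add,
        smul_dotProduct, dotProduct_smul, Matrix.mulVec_single_one, single_one_dotProduct,
        Matrix.col_apply, smul_eq_mul, hs]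
      linear_combination hw
    have hzS : z ⬝ᵥ S.mulVec w = 0 := by
      rw [Matrix.dotProduct_mulVec, ← Matrix.mulVec_transpose, hS.eq, hSz, zero_dotProduct]
    obtain ⟨p', q', hpq', hx⟩ := exists_binary_zero (z ⬝ᵥ R.mulVec z)
      ((z ⬝ᵥ R.mulVec w + w ⬝ᵥ R.mulVec z) / 2) (w ⬝ᵥ R.mulVec w)
    refine ⟨p' • z + q' • w, ?_, ?_, ?_⟩
    · intro h0
      have hp' : p' = 0 := by
        have := congrFun h0 i
        simp only [Pi.add_apply, Pi.smul_apply, hwi, smul_eq_mul, mul_zero, add_zero,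
          Pi.zero_apply] at this
        exact (mul_eq_zero.mp this).resolve_right hi
      have hq' : q' ≠ 0 := hpq'.resolve_left (not_not.mpr hp')
      have hw0 : w = 0 := by simpa [hp', hq'] using h0
      rw [hw0] at hw1 hw2
      exact hpq.elim (fun h => h hw1.symm) fun h => h hw2.symm
    · simp only [Matrix.mulVec_add, Matrix.mulVec_smul, hSz, dotProduct_add, add_dotProduct,
        smul_dotProduct, dotProduct_smul, hzS, hwS, smul_zero, dotProduct_zero, add_zero]
    · simp only [Matrix.mulVec_add, Matrix.mulVec_smul, dotProduct_add, add_dotProduct,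
        smul_dotProduct, dotProduct_smul, smul_eq_mul]
      linear_combination hx
  by_cases hdet : S₂.det = 0
  · obtain ⟨z, hz, hSz⟩ := Matrix.exists_mulVec_eq_zero_iff.mpr hdet
    obtain ⟨x, hx, h2, h1⟩ := key S₂ S₁ h₂ z hz hSz
    exact ⟨x, hx, h1, h2⟩
  -- An eigenvalue of `S₂⁻¹ * S₁` singles out a singular member of the pencil.
  · obtain ⟨c, hc⟩ := Module.End.exists_eigenvalue (Matrix.toLin' (S₂⁻¹ * S₁))
    obtain ⟨z, hz⟩ := hc.exists_hasEigenvector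
    have h0 : (S₁ - c • S₂).mulVec z = 0 := by
      have h1 := hz.apply_eq_smul
      rw [Matrix.toLin'_apply, ← Matrix.mulVec_mulVec] at h1
      have h2 := congrArg S₂.mulVec h1
      rw [Matrix.mulVec_mulVec, Matrix.mul_nonsing_inv _ (isUnit_iff_ne_zero.mpr hdet),
        Matrix.one_mulVec, Matrix.mulVec_smul] at h2
      rw [Matrix.sub_mulVec, Matrix.smul_mulVec, h2, sub_self]
    obtain ⟨x, hx, h3, h4⟩ := key (S₁ - c • S₂) S₂ (h₁.sub (h₂.smul c)) z hz.2 h0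
    refine ⟨x, hx, ?_, h4⟩
    rw [Matrix.sub_mulVec, Matrix.smul_mulVec, dotProduct_sub, dotProduct_smul, h4, smul_zero,
      sub_zero] at h3
    exact h3

end BinaryQuadratic

/-! ### Local structure of the curve at a special point -/

section SpecialPoint

lemma sum_fin_three_rotate (f : Fin 3 → ℂ) (k : Fin 3) :
    ∑ i, f i = f k + f (k + 1) + f (k + 2) := by
  rw [Fin.sum_univ_three]
  fin_cases k <;> simp <;> ring

/-- Cramer's rule with the cofactors of column `k`. It isolates the factor `M.mulVec c`, which
vanishes at a special point. -/
lemma mul_det_eq (M : Matrix (Fin 3) (Fin 3) ℂ) (c : Fin 3 → ℂ) (k : Fin 3) :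
    c k * M.det = (M 1 (k + 1) * M 2 (k + 2) - M 1 (k + 2) * M 2 (k + 1)) * M.mulVec c 0
      + (M 2 (k + 1) * M 0 (k + 2) - M 0 (k + 1) * M 2 (k + 2)) * M.mulVec c 1
      + (M 0 (k + 1) * M 1 (k + 2) - M 0 (k + 2) * M 1 (k + 1)) * M.mulVec c 2 := by
  rw [Matrix.det_fin_three]
  simp only [Matrix.mulVec, dotProduct, Fin.sum_univ_three]
  fin_cases k <;> simp <;> ring

variable (e : Fin 2 ⊕ Fin 3 ≃ Fin 5) (F : MvPolynomial (Fin 5) ℂ) (a : Fin 2 × Fin 3 → ℂ)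

/-- The line with coordinates `a` lies on the cubic, and the derivative in the direction `c` vanishes
along it. -/
structure IsSpecial (c : Fin 3 → ℂ) : Prop where
  ne_zero : c ≠ 0
  fano : ∀ i j k : Fin 2, polar F (vec e a i) (vec e a j) (vec e a k) = 0
  mulVec_eq_zero : (derivMatrix e F a).mulVec c = 0

variable {e F a}

lemma memCurve_iff_exists (hF : F.IsHomogeneous 3) :
    MemCurve e F a ↔ ∃ c, IsSpecial e F a c := by
  rw [memCurve_iff hF, ← Matrix.exists_mulVec_eq_zero_iff]
  exact ⟨fun ⟨h, c, hc, hM⟩ => ⟨c, hc, h, hM⟩, fun ⟨c, h⟩ => ⟨h.fano, c, h.ne_zero, h.mulVec_eq_zero⟩⟩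

lemma polar_complVec (x y : Fin 5 → ℂ) (c : Fin 3 → ℂ) :
    polar F x y (complVec e c) = ∑ k, polar F x y (Pi.single (e (Sum.inr k)) 1) * c k := by
  rw [complVec_apply, map_sum]
  exact Finset.sum_congr rfl fun k _ => by rw [map_smul, smul_eq_mul, mul_comm]

lemma derivMatrix_mulVec (c : Fin 3 → ℂ) :
    (derivMatrix e F a).mulVec c = ![polar F (vec e a 0) (vec e a 0) (complVec e c),
      polar F (vec e a 0) (vec e a 1) (complVec e c),
      polar F (vec e a 1) (vec e a 1) (complVec e c)] := by
  funext r
  simp only [polar_complVec]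
  fin_cases r <;> rfl

lemma polar_vec_vec_complVec_eq_zero {c : Fin 3 → ℂ} (h : (derivMatrix e F a).mulVec c = 0)
    (i j : Fin 2) : polar F (vec e a i) (vec e a j) (complVec e c) = 0 := by
  rw [derivMatrix_mulVec] at h
  have h0 := congrFun h 0
  have h1 := congrFun h 1
  have h2 := congrFun h 2
  simp only [Matrix.cons_val_zero, Matrix.cons_val_one, Matrix.cons_val, Pi.zero_apply] at h0 h1 h2
  fin_cases i <;> fin_cases j
  · exact h0
  · exact h1
  · exact (polar_swap _ _ _).trans h1
  · exact h2

/-- The polarized form of smoothness. -/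
lemma polar_singular_false (hF : F.IsHomogeneous 3) (hX : IsSmooth F) {x : Fin 5 → ℂ} (hx : x ≠ 0)
    (hv : ∀ u, polar F x x (vec e a u) = 0)
    (hE : ∀ k, polar F x x (Pi.single (e (Sum.inr k)) 1) = 0) : False := by
  have hall : ∀ z, polar F x x z = 0 := by
    intro z
    rw [eq_vec_add_complVec e a z, map_add, map_add, map_smul, map_smul, hv, hv, polar_complVec]
    simp [hE]
  obtain ⟨i, hi⟩ := hX x hx (by rw [eval_eq_polar hF, hall])
  exact hi (by rw [eval_pderiv hF, hall, mul_zero])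

/-- On a smooth cubic, the derivatives have no common zero on a line. -/
lemma derivMatrix_no_common_zero (hF : F.IsHomogeneous 3) (hX : IsSmooth F)
    (hfano : ∀ i j k : Fin 2, polar F (vec e a i) (vec e a j) (vec e a k) = 0) {p q : ℂ}
    (hpq : p ≠ 0 ∨ q ≠ 0)
    (h : ∀ k, derivMatrix e F a 0 k * p ^ 2 + 2 * derivMatrix e F a 1 k * (p * q)
      + derivMatrix e F a 2 k * q ^ 2 = 0) : False := by
  let x := p • vec e a 0 + q • vec e a 1
  have hx0 : x (e (Sum.inl 0)) = p := by simp [x, vec_inl]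
  have hx1 : x (e (Sum.inl 1)) = q := by simp [x, vec_inl]
  have hx : x ≠ 0 := by
    intro h0
    rw [h0] at hx0 hx1
    exact hpq.elim (fun h => h hx0.symm) fun h => h hx1.symm
  have hxx : ∀ z, polar F x x z = polar F (vec e a 0) (vec e a 0) z * p ^ 2
      + 2 * polar F (vec e a 0) (vec e a 1) z * (p * q)
      + polar F (vec e a 1) (vec e a 1) z * q ^ 2 := by
    intro z
    simp only [x, map_add, LinearMap.add_apply, map_smul, LinearMap.smul_apply, smul_eq_mul]
    rw [polar_swap (vec e a 1) (vec e a 0)]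
    ring
  refine polar_singular_false (e := e) (a := a) hF hX hx (fun u => ?_) fun k => ?_
  · rw [hxx, hfano, hfano, hfano]; ring
  · rw [hxx]; exact h k

lemma polar_add_smul_right_eval {f : MvPolynomial (Fin 2 × Fin 3) ℂ} {y : Fin 2 × Fin 3 → ℂ}
    {κ : ℂ} {x₀ x₁ y₀ y₁ z₀ z₁ : Fin 5 → ℂ}
    (h : ∀ t : ℂ, eval (a + t • y) f
      = κ * polar F (x₀ + t • x₁) (y₀ + t • y₁) (z₀ + t • z₁)) :
    eval y (taylorForm a 1 f)
      = κ * (polar F x₁ y₀ z₀ + polar F x₀ y₁ z₀ + polar F x₀ y₀ z₁) ∧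
    eval y (taylorForm a 2 f)
      = κ * (polar F x₁ y₁ z₀ + polar F x₁ y₀ z₁ + polar F x₀ y₁ z₁) := by
  have h' : ∀ t : ℂ, eval (a + t • y) f = (Polynomial.C (κ * polar F x₀ y₀ z₀)
      + Polynomial.C (κ * (polar F x₁ y₀ z₀ + polar F x₀ y₁ z₀ + polar F x₀ y₀ z₁))
        * Polynomial.X ^ 1
      + Polynomial.C (κ * (polar F x₁ y₁ z₀ + polar F x₁ y₀ z₁ + polar F x₀ y₁ z₁))
        * Polynomial.X ^ 2
      + Polynomial.C (κ * polar F x₁ y₁ z₁) * Polynomial.X ^ 3).eval t := by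
    intro t
    rw [h]
    simp only [map_add, LinearMap.add_apply, map_smul, LinearMap.smul_apply, smul_eq_mul,
      Polynomial.eval_add, Polynomial.eval_mul, Polynomial.eval_C, Polynomial.eval_pow,
      Polynomial.eval_X]
    ring
  rw [taylorForm_eval_eq_coeff a y f _ h', taylorForm_eval_eq_coeff a y f _ h']
  constructor
  · simp only [Polynomial.coeff_add, Polynomial.coeff_C_mul_X_pow, Polynomial.coeff_C]
    norm_num
  · simp only [Polynomial.coeff_add, Polynomial.coeff_C_mul_X_pow, Polynomial.coeff_C]
    norm_num

variable (e F) in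
/-- The four equations of the Fano surface in a chart. -/
def fanoEq : Fin 4 → ChartRing :=
  ![lineCoeff e F 3 0, lineCoeff e F 2 1, lineCoeff e F 1 2, lineCoeff e F 0 3]

variable (F) in
/-- The linear parts at `a` of the equations of the Fano surface. -/
def fanoDiff (e : Fin 2 ⊕ Fin 3 ≃ Fin 5) (a : Fin 2 × Fin 3 → ℂ) :
    (Fin 2 × Fin 3 → ℂ) →ₗ[ℂ] (Fin 4 → ℂ) where
  toFun y i := eval y (taylorForm a 1 (fanoEq e F i))
  map_add' y z := funext fun i => eval_add_of_isHomogeneous_one (taylorForm_isHomogeneous _ _ _) y z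
  map_smul' t y := funext fun i => by
    rw [eval_smul_of_isHomogeneous (taylorForm_isHomogeneous _ _ _), pow_one]; rfl

lemma fanoEq_mem (i : Fin 4) : fanoEq e F i ∈ curveIdeal e F := by
  refine Ideal.subset_span ?_
  fin_cases i <;> simp [fanoEq]

lemma secondTypeDet_mem : secondTypeDet e F ∈ curveIdeal e F :=
  Ideal.subset_span (by simp)

lemma eval_eq_zero_of_mem_curveIdeal {f : ChartRing} (hf : f ∈ curveIdeal e F)
    {x : Fin 2 × Fin 3 → ℂ} (hx : ∀ i, eval x (fanoEq e F i) = 0)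
    (hd : eval x (secondTypeDet e F) = 0) : eval x f = 0 := by
  have h : curveIdeal e F ≤ RingHom.ker (eval x) := by
    rw [curveIdeal, Ideal.span_le]
    rintro _ (rfl | rfl | rfl | rfl | rfl)
    exacts [hx 0, hx 1, hx 2, hx 3, hd]
  exact h hf

/-- The tangent vector to the chart given by a direction `c` and a linear form `l` on the line. -/
def tangent (c : Fin 3 → ℂ) (l : Fin 2 → ℂ) : Fin 2 × Fin 3 → ℂ := fun i => l i.1 * c i.2

lemma complVec_tangent (c : Fin 3 → ℂ) (l : Fin 2 → ℂ) (u : Fin 2) :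
    (complVec e fun k => tangent c l (u, k)) = l u • complVec e c := by
  rw [← map_smul]; rfl

variable (hF : F.IsHomogeneous 3)
include hF

/-- These are the first two orders of the trilinear expansion. Each quadratic term pairs one `vec`
with two displacements, hence the last clause, which is needed at triple lines. -/
lemma taylorForm_fanoEq (y : Fin 2 × Fin 3 → ℂ) :
    (eval y (taylorForm a 1 (fanoEq e F 0))
        = 3 * polar F (vec e a 0) (vec e a 0) (complVec e fun k => y (0, k)) ∧
      eval y (taylorForm a 1 (fanoEq e F 1))
        = 3 * polar F (vec e a 0) (vec e a 0) (complVec e fun k => y (1, k))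
          + 6 * polar F (vec e a 0) (vec e a 1) (complVec e fun k => y (0, k)) ∧
      eval y (taylorForm a 1 (fanoEq e F 2))
        = 3 * polar F (vec e a 1) (vec e a 1) (complVec e fun k => y (0, k))
          + 6 * polar F (vec e a 0) (vec e a 1) (complVec e fun k => y (1, k)) ∧
      eval y (taylorForm a 1 (fanoEq e F 3))
        = 3 * polar F (vec e a 1) (vec e a 1) (complVec e fun k => y (1, k))) ∧
    ((∀ u v w : Fin 2, polar F (vec e a u) (complVec e fun k => y (v, k))
        (complVec e fun k => y (w, k)) = 0) →
      ∀ i, eval y (taylorForm a 2 (fanoEq e F i)) = 0) := by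
  have h := fun t : ℂ => eval_lineCoeff_cubic (e := e) hF (a + t • y)
  simp only [vec_add_smul] at h
  have h0 := polar_add_smul_right_eval (κ := 1) fun t => by rw [one_mul]; exact (h t).1
  have h1 := polar_add_smul_right_eval fun t => (h t).2.1
  have h2 := polar_add_smul_right_eval fun t => (h t).2.2.1
  have h3 := polar_add_smul_right_eval (κ := 1) fun t => by rw [one_mul]; exact (h t).2.2.2
  refine ⟨⟨?_, ?_, ?_, ?_⟩, fun hz i => ?_⟩
  · refine h0.1.trans ?_
    rw [polar_rotate (complVec e _) (vec e a 0) (vec e a 0),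
      polar_swap_right (vec e a 0) (complVec e _) (vec e a 0)]
    ring
  · refine h1.1.trans ?_
    rw [polar_rotate (complVec e _) (vec e a 0) (vec e a 1),
      polar_swap_right (vec e a 0) (complVec e _) (vec e a 1)]
    ring
  · refine h2.1.trans ?_
    rw [polar_rotate (complVec e _) (vec e a 1) (vec e a 1),
      polar_swap_right (vec e a 0) (complVec e _) (vec e a 1)]
    ring
  · refine h3.1.trans ?_
    rw [polar_rotate (complVec e _) (vec e a 1) (vec e a 1),
      polar_swap_right (vec e a 1) (complVec e _) (vec e a 1)]
    ring
  · have hz1 : ∀ u v w : Fin 2, polar F (complVec e fun k => y (v, k)) (vec e a u)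
        (complVec e fun k => y (w, k)) = 0 := fun u v w => by rw [polar_swap, hz]
    have hz2 : ∀ u v w : Fin 2, polar F (complVec e fun k => y (v, k)) (complVec e fun k => y (w, k))
        (vec e a u) = 0 := fun u v w => by rw [← polar_rotate, hz]
    fin_cases i
    · refine h0.2.trans ?_
      rw [hz, hz1, hz2]; ring
    · refine h1.2.trans ?_
      rw [hz, hz1, hz2]; ring
    · refine h2.2.trans ?_
      rw [hz, hz1, hz2]; ring
    · refine h3.2.trans ?_
      rw [hz, hz1, hz2]; ring

lemma fanoEq_mem_maxIdeal
    (hfano : ∀ i j k : Fin 2, polar F (vec e a i) (vec e a j) (vec e a k) = 0) (i : Fin 4) :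
    fanoEq e F i ∈ maxIdeal a := by
  obtain ⟨h0, h1, h2, h3⟩ := eval_lineCoeff_cubic (e := e) hF a
  simp only [hfano, mul_zero] at h0 h1 h2 h3
  fin_cases i
  exacts [h0, h1, h2, h3]

lemma exists_derivMatrix_polynomial (y : Fin 2 × Fin 3 → ℂ) :
    ∃ Q : Fin 3 → Fin 3 → Polynomial ℂ, ∀ (t : ℂ) (r k : Fin 3),
      (Q r k).eval t = derivMatrix e F (a + t • y) r k := by
  refine ⟨fun r k => Polynomial.C (![3⁻¹, 6⁻¹, 3⁻¹] r) *
    toLine a y (lineCoeff e (pderiv (e (Sum.inr k)) F) (2 - (r : ℕ)) (r : ℕ)), fun t r k => ?_⟩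
  obtain ⟨h0, h1, h2⟩ := eval_lineCoeff_pderiv (e := e) hF (a + t • y) (e (Sum.inr k))
  rw [Polynomial.eval_mul, Polynomial.eval_C, eval_toLine]
  fin_cases r
  · simp [h0, derivMatrix]
  · simp [h1, derivMatrix]
  · simp [h2, derivMatrix]

variable {c : Fin 3 → ℂ} (hs : IsSpecial e F a c) {k₀ : Fin 3} (hk₀ : c k₀ ≠ 0)
include hs hk₀

/-- Along a tangent direction of the Fano surface which moves the line inside its plane. -/
lemma taylorForm_secondTypeDet_tangent : ∃ κ : ℂ, κ ≠ 0 ∧ ∀ l : Fin 2 → ℂ,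
    eval (tangent c l) (taylorForm a 1 (secondTypeDet e F)) = κ *
      ((derivMatrix e F a 1 (k₀ + 1) * derivMatrix e F a 2 (k₀ + 2)
        - derivMatrix e F a 1 (k₀ + 2) * derivMatrix e F a 2 (k₀ + 1)) *
          (2 * l 0 * polar F (vec e a 0) (complVec e c) (complVec e c)) +
      (derivMatrix e F a 2 (k₀ + 1) * derivMatrix e F a 0 (k₀ + 2)
        - derivMatrix e F a 0 (k₀ + 1) * derivMatrix e F a 2 (k₀ + 2)) *
          (l 0 * polar F (vec e a 1) (complVec e c) (complVec e c)
            + l 1 * polar F (vec e a 0) (complVec e c) (complVec e c)) +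
      (derivMatrix e F a 0 (k₀ + 1) * derivMatrix e F a 1 (k₀ + 2)
        - derivMatrix e F a 0 (k₀ + 2) * derivMatrix e F a 1 (k₀ + 1)) *
          (2 * l 1 * polar F (vec e a 1) (complVec e c) (complVec e c))) ∧
    ((∀ u, polar F (vec e a u) (complVec e c) (complVec e c) = 0) →
      eval (tangent c l) (taylorForm a 2 (secondTypeDet e F)) =
        κ * polar F (complVec e c) (complVec e c) (complVec e c) *
      ((derivMatrix e F a 1 (k₀ + 1) * derivMatrix e F a 2 (k₀ + 2)
        - derivMatrix e F a 1 (k₀ + 2) * derivMatrix e F a 2 (k₀ + 1)) * l 0 ^ 2 +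
      (derivMatrix e F a 2 (k₀ + 1) * derivMatrix e F a 0 (k₀ + 2)
        - derivMatrix e F a 0 (k₀ + 1) * derivMatrix e F a 2 (k₀ + 2)) * (l 0 * l 1) +
      (derivMatrix e F a 0 (k₀ + 1) * derivMatrix e F a 1 (k₀ + 2)
        - derivMatrix e F a 0 (k₀ + 2) * derivMatrix e F a 1 (k₀ + 1)) * l 1 ^ 2)) := by
  -- 54 comes from `eval_secondTypeDet`, and the division by `c k₀` from `mul_det_eq`.
  refine ⟨54 / c k₀, div_ne_zero (by norm_num) hk₀, fun l => ?_⟩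
  obtain ⟨Q, hQ⟩ := exists_derivMatrix_polynomial (e := e) (a := a) hF (tangent c l)
  have hQ0 : ∀ r k, (Q r k).eval 0 = derivMatrix e F a r k := fun r k => by
    rw [hQ, zero_smul, add_zero]
  set n := complVec e c with hn
  have hker : ∀ u v, polar F (vec e a u) (vec e a v) n = 0 :=
    polar_vec_vec_complVec_eq_zero hs.mulVec_eq_zero
  -- The matrix kills `c` at `t = 0`, so each entry is divisible by `t`. The determinant is then `t`
  -- times a polynomial `R` whose constant term involves only the minors at `a`.
  have hmv : ∀ t : ℂ, (derivMatrix e F (a + t • tangent c l)).mulVec c =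
      ![t * (2 * l 0 * polar F (vec e a 0) n n + t * (l 0 ^ 2 * polar F n n n)),
        t * (l 0 * polar F (vec e a 1) n n + l 1 * polar F (vec e a 0) n n
          + t * (l 0 * l 1 * polar F n n n)),
        t * (2 * l 1 * polar F (vec e a 1) n n + t * (l 1 ^ 2 * polar F n n n))] := by
    intro t
    rw [derivMatrix_mulVec]
    simp only [vec_add_smul, complVec_tangent, ← hn, map_add, LinearMap.add_apply, map_smul,
      LinearMap.smul_apply, smul_eq_mul, hker, polar_swap n (vec e a _) n]
    congr 1
    · ring
    · congr 1
      · ring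
      · congr 1
        ring
  let α := Q 1 (k₀ + 1) * Q 2 (k₀ + 2) - Q 1 (k₀ + 2) * Q 2 (k₀ + 1)
  let β := Q 2 (k₀ + 1) * Q 0 (k₀ + 2) - Q 0 (k₀ + 1) * Q 2 (k₀ + 2)
  let γ := Q 0 (k₀ + 1) * Q 1 (k₀ + 2) - Q 0 (k₀ + 2) * Q 1 (k₀ + 1)
  let R : Polynomial ℂ := Polynomial.C (54 / c k₀) *
    (α * (Polynomial.C (2 * l 0 * polar F (vec e a 0) n n)
        + Polynomial.X * Polynomial.C (l 0 ^ 2 * polar F n n n))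
      + β * (Polynomial.C (l 0 * polar F (vec e a 1) n n + l 1 * polar F (vec e a 0) n n)
        + Polynomial.X * Polynomial.C (l 0 * l 1 * polar F n n n))
      + γ * (Polynomial.C (2 * l 1 * polar F (vec e a 1) n n)
        + Polynomial.X * Polynomial.C (l 1 ^ 2 * polar F n n n)))
  have hR : ∀ t : ℂ, eval (a + t • tangent c l) (secondTypeDet e F)
      = (R * Polynomial.X).eval t := by
    intro t
    have h1 := mul_det_eq (derivMatrix e F (a + t • tangent c l)) c k₀
    rw [hmv] at h1
    have h2 : (derivMatrix e F (a + t • tangent c l)).det = _ := eq_div_of_mul_eq hk₀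
      ((mul_comm _ _).trans h1)
    rw [eval_secondTypeDet hF, h2]
    simp only [R, α, β, γ, Polynomial.eval_add, Polynomial.eval_sub, Polynomial.eval_mul,
      Polynomial.eval_C, Polynomial.eval_X, hQ, Matrix.cons_val_zero, Matrix.cons_val_one,
      Matrix.cons_val]
    ring
  refine ⟨?_, fun hm => ?_⟩
  · rw [taylorForm_eval_eq_coeff a _ _ _ hR, Polynomial.coeff_mul_X,
      Polynomial.coeff_zero_eq_eval_zero]
    simp only [R, α, β, γ, Polynomial.eval_add, Polynomial.eval_sub, Polynomial.eval_mul,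
      Polynomial.eval_C, Polynomial.eval_X, hQ0]
    ring
  -- With the mixed terms gone, `R` acquires another factor `t`, and the quadratic Taylor form again
  -- needs the minors only at `t = 0`.
  · have hR' : R = Polynomial.C (54 / c k₀ * polar F n n n) *
        (α * Polynomial.C (l 0 ^ 2) + β * Polynomial.C (l 0 * l 1) + γ * Polynomial.C (l 1 ^ 2))
        * Polynomial.X := by
      simp only [R, hm, mul_zero, add_zero, Polynomial.C_0, zero_add, Polynomial.C_mul]
      ring
    rw [taylorForm_eval_eq_coeff a _ _ _ hR, hR', Polynomial.coeff_mul_X, Polynomial.coeff_mul_X,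
      Polynomial.coeff_zero_eq_eval_zero]
    simp only [α, β, γ, Polynomial.eval_add, Polynomial.eval_sub, Polynomial.eval_mul,
      Polynomial.eval_C, hQ0]

variable (hX : IsSmooth F)
include hX

/-- Since `c k₀ ≠ 0`, the quadratic of column `k₀` is a combination of the other two. A common zero
of those two would be a common zero of all three, hence a singular point of the cubic. -/
lemma derivMatrix_resultant_ne_zero :
    (derivMatrix e F a 2 (k₀ + 1) * derivMatrix e F a 0 (k₀ + 2)
        - derivMatrix e F a 0 (k₀ + 1) * derivMatrix e F a 2 (k₀ + 2)) ^ 2 -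
      4 * (derivMatrix e F a 1 (k₀ + 1) * derivMatrix e F a 2 (k₀ + 2)
        - derivMatrix e F a 1 (k₀ + 2) * derivMatrix e F a 2 (k₀ + 1)) *
        (derivMatrix e F a 0 (k₀ + 1) * derivMatrix e F a 1 (k₀ + 2)
        - derivMatrix e F a 0 (k₀ + 2) * derivMatrix e F a 1 (k₀ + 1)) ≠ 0 := by
  refine resultant_ne_zero fun p q hpq h1 h2 => ?_
  refine derivMatrix_no_common_zero hF hX hs.fano hpq ?_
  set M := derivMatrix e F a
  have hsum : ∀ r, M r k₀ * c k₀ + M r (k₀ + 1) * c (k₀ + 1) + M r (k₀ + 2) * c (k₀ + 2) = 0 :=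
    fun r => by
      rw [← sum_fin_three_rotate (fun k => M r k * c k) k₀]
      exact congrFun hs.mulVec_eq_zero r
  have h0 : M 0 k₀ * p ^ 2 + 2 * M 1 k₀ * (p * q) + M 2 k₀ * q ^ 2 = 0 := by
    refine (mul_eq_zero.mp (?_ : c k₀ * _ = 0)).resolve_left hk₀
    linear_combination p ^ 2 * hsum 0 + 2 * (p * q) * hsum 1 + q ^ 2 * hsum 2
      - c (k₀ + 1) * h1 - c (k₀ + 2) * h2
  intro k
  have hk : k = k₀ ∨ k = k₀ + 1 ∨ k = k₀ + 2 := by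
    clear * -
    revert k k₀; decide
  rcases hk with rfl | rfl | rfl
  exacts [h0, h1, h2]

/-- The tangent space of the Fano surface at a special point. -/
lemma eq_tangent_of_fanoDiff_eq_zero {y : Fin 2 × Fin 3 → ℂ} (hy : fanoDiff F e a y = 0) :
    y = tangent c fun u => y (u, k₀) / c k₀ := by
  have hres := derivMatrix_resultant_ne_zero hF hs hk₀ hX
  obtain ⟨⟨t0, t1, t2, t3⟩, -⟩ := taylorForm_fanoEq (e := e) (a := a) hF y
  have y0 := t0.symm.trans (congrFun hy 0)
  have y1 := t1.symm.trans (congrFun hy 1)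
  have y2 := t2.symm.trans (congrFun hy 2)
  have y3 := t3.symm.trans (congrFun hy 3)
  have hpol : ∀ u : Fin 2,
      polar F (vec e a 0) (vec e a 0) (complVec e fun k => y (u, k))
        = (derivMatrix e F a).mulVec (fun k => y (u, k)) 0 ∧
      polar F (vec e a 0) (vec e a 1) (complVec e fun k => y (u, k))
        = (derivMatrix e F a).mulVec (fun k => y (u, k)) 1 ∧
      polar F (vec e a 1) (vec e a 1) (complVec e fun k => y (u, k))
        = (derivMatrix e F a).mulVec (fun k => y (u, k)) 2 := fun u => by
    rw [derivMatrix_mulVec]; exact ⟨rfl, rfl, rfl⟩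
  set M := derivMatrix e F a with hMdef
  have hsum : ∀ r, M r k₀ * c k₀ + M r (k₀ + 1) * c (k₀ + 1) + M r (k₀ + 2) * c (k₀ + 2) = 0 :=
    fun r => by
      rw [← sum_fin_three_rotate (fun k => M r k * c k) k₀]
      exact congrFun hs.mulVec_eq_zero r
  -- Column `k₀` is eliminated using the kernel vector `c`. The four tangent equations then say that
  -- the corrected coordinates form a linear syzygy of two coprime quadratics.
  have hmv : ∀ (u : Fin 2) (r : Fin 3), M.mulVec (fun k => y (u, k)) r
      = (y (u, k₀ + 1) - y (u, k₀) / c k₀ * c (k₀ + 1)) * M r (k₀ + 1)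
        + (y (u, k₀ + 2) - y (u, k₀) / c k₀ * c (k₀ + 2)) * M r (k₀ + 2) := by
    intro u r
    have : M.mulVec (fun k => y (u, k)) r = M r k₀ * y (u, k₀) + M r (k₀ + 1) * y (u, k₀ + 1)
        + M r (k₀ + 2) * y (u, k₀ + 2) := sum_fin_three_rotate (fun k => M r k * y (u, k)) k₀
    rw [this]
    have h1 : y (u, k₀) = y (u, k₀) / c k₀ * c k₀ := (div_mul_cancel₀ _ hk₀).symm
    linear_combination M r k₀ * h1 + y (u, k₀) / c k₀ * hsum r
  simp only [hpol, hmv, Pi.zero_apply] at y0 y1 y2 y3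
  obtain ⟨x0, x1, z0, z1⟩ := linear_syzygy_eq_zero hres
    (x₀ := y (0, k₀ + 1) - y (0, k₀) / c k₀ * c (k₀ + 1))
    (x₁ := y (1, k₀ + 1) - y (1, k₀) / c k₀ * c (k₀ + 1))
    (y₀ := y (0, k₀ + 2) - y (0, k₀) / c k₀ * c (k₀ + 2))
    (y₁ := y (1, k₀ + 2) - y (1, k₀) / c k₀ * c (k₀ + 2))
    (by linear_combination y0 / 3) (by linear_combination y1 / 3)
    (by linear_combination y2 / 3) (by linear_combination y3 / 3)
  funext ⟨u, k⟩
  have hk : k = k₀ ∨ k = k₀ + 1 ∨ k = k₀ + 2 := by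
    clear * -
    revert k k₀; decide
  simp only [tangent]
  rcases hk with rfl | rfl | rfl
  · exact (div_mul_cancel₀ _ hk₀).symm
  · fin_cases u
    · exact sub_eq_zero.mp x0
    · exact sub_eq_zero.mp x1
  · fin_cases u
    · exact sub_eq_zero.mp z0
    · exact sub_eq_zero.mp z1

omit hk₀ hX in
lemma fanoDiff_tangent (l : Fin 2 → ℂ) : fanoDiff F e a (tangent c l) = 0 := by
  have hker : ∀ u v, polar F (vec e a u) (vec e a v) (complVec e c) = 0 :=
    polar_vec_vec_complVec_eq_zero hs.mulVec_eq_zero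
  obtain ⟨⟨t0, t1, t2, t3⟩, -⟩ := taylorForm_fanoEq (e := e) (a := a) hF (tangent c l)
  simp only [complVec_tangent, map_smul, hker, smul_zero, mul_zero, add_zero] at t0 t1 t2 t3
  funext i
  fin_cases i
  exacts [t0, t1, t2, t3]

/-- A splitting of the tangent space of the chart at a special point, given a basis of the linear
forms on the line. -/
lemma exists_splitting {l : Fin 2 → Fin 2 → ℂ} (hl : l 0 0 * l 1 1 - l 0 1 * l 1 0 ≠ 0) :
    ∃ (s : (Fin 4 → ℂ) →ₗ[ℂ] (Fin 2 × Fin 3 → ℂ))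
      (μ : Fin 2 → (Fin 2 × Fin 3 → ℂ) →ₗ[ℂ] ℂ),
      (∀ z, fanoDiff F e a (s z) = z) ∧
      (∀ y, y = s (fanoDiff F e a y) + μ 0 y • tangent c (l 0) + μ 1 y • tangent c (l 1)) ∧
      ∀ i j, μ i (tangent c (l j)) = if i = j then 1 else 0 := by
  set Λ := fanoDiff F e a
  have hsurj : LinearMap.range Λ = ⊤ := by
    -- A kernel vector is determined by its two coordinates `(u, k₀)`, so the kernel has dimension
    -- at most 2 and the rank is at least 6 - 2 = 4.
    let φ : LinearMap.ker Λ →ₗ[ℂ] (Fin 2 → ℂ) :=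
      (LinearMap.pi fun u => LinearMap.proj (u, k₀)).comp (LinearMap.ker Λ).subtype
    have hφ : Function.Injective φ := by
      rw [← LinearMap.ker_eq_bot, LinearMap.ker_eq_bot']
      rintro ⟨y, hy⟩ h
      have h1 := eq_tangent_of_fanoDiff_eq_zero hF hs hk₀ hX hy
      have h2 : ∀ u, y (u, k₀) = 0 := fun u => congrFun h u
      refine Subtype.ext (h1.trans (funext fun i => ?_))
      simp [tangent, h2]
    have h1 := LinearMap.finrank_le_finrank_of_injective hφ
    have h2 := Λ.finrank_range_add_finrank_ker
    have h3 : Module.finrank ℂ (Fin 2 × Fin 3 → ℂ) = 6 := by simp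
    have h4 : Module.finrank ℂ (Fin 2 → ℂ) = 2 := by simp
    refine Submodule.eq_top_of_finrank_eq (le_antisymm (Submodule.finrank_le _) ?_)
    have h5 : Module.finrank ℂ (Fin 4 → ℂ) = 4 := by simp
    omega
  obtain ⟨s, hsΛ⟩ := Λ.exists_rightInverse_of_surjective hsurj
  have hsΛ' : ∀ z, Λ (s z) = z := fun z => congrArg (fun f : (Fin 4 → ℂ) →ₗ[ℂ] _ => f z) hsΛ
  let N : Fin 2 → (Fin 2 × Fin 3 → ℂ) →ₗ[ℂ] ℂ := fun u =>
    (c k₀)⁻¹ • (LinearMap.proj (u, k₀)).comp (LinearMap.id - s.comp Λ)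
  have hN : ∀ u y, N u y = (y - s (Λ y)) (u, k₀) / c k₀ := fun u y => by
    simp only [N, LinearMap.smul_apply, LinearMap.comp_apply, LinearMap.sub_apply,
      LinearMap.id_apply, LinearMap.proj_apply, smul_eq_mul, div_eq_inv_mul]
  let δ := l 0 0 * l 1 1 - l 0 1 * l 1 0
  -- `N` gives the components of the tangent part in the standard basis; inverting the 2 × 2 matrix
  -- `l` converts them to the basis `l 0`, `l 1`.
  let μ : Fin 2 → (Fin 2 × Fin 3 → ℂ) →ₗ[ℂ] ℂ :=
    ![δ⁻¹ • (l 1 1 • N 0 - l 1 0 • N 1), δ⁻¹ • (l 0 0 • N 1 - l 0 1 • N 0)]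
  have hμ0 : ∀ y, μ 0 y = δ⁻¹ * (l 1 1 * N 0 y - l 1 0 * N 1 y) := fun y => rfl
  have hμ1 : ∀ y, μ 1 y = δ⁻¹ * (l 0 0 * N 1 y - l 0 1 * N 0 y) := fun y => rfl
  have hδ : δ⁻¹ * (l 0 0 * l 1 1 - l 0 1 * l 1 0) = 1 := inv_mul_cancel₀ hl
  refine ⟨s, μ, hsΛ', fun y => ?_, fun i j => ?_⟩
  · have h0 : Λ (y - s (Λ y)) = 0 := by rw [map_sub, hsΛ', sub_self]
    have h1 := eq_tangent_of_fanoDiff_eq_zero hF hs hk₀ hX h0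
    have h2 : y = s (Λ y) + tangent c fun u => N u y := by
      simp only [hN]
      rw [← h1]; abel
    have h3 : (tangent c fun u => N u y) = μ 0 y • tangent c (l 0) + μ 1 y • tangent c (l 1) := by
      funext ⟨u, k⟩
      simp only [tangent, Pi.add_apply, Pi.smul_apply, smul_eq_mul, hμ0, hμ1]
      obtain rfl | rfl : u = 0 ∨ u = 1 := by fin_cases u <;> simp
      · linear_combination (-N 0 y * c k) * hδ
      · linear_combination (-N 1 y * c k) * hδ
    rw [add_assoc, ← h3]
    exact h2
  · have h1 : ∀ u, N u (tangent c (l j)) = l j u := fun u => by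
      rw [hN, fanoDiff_tangent hF hs, map_zero, sub_zero, tangent, mul_div_cancel_right₀ _ hk₀]
    fin_cases i
    · change μ 0 _ = _
      rw [hμ0, h1, h1]
      fin_cases j
      · simp only [Fin.zero_eta, if_true]; linear_combination hδ
      · simp; ring_nf; simp
    · change μ 1 _ = _
      rw [hμ1, h1, h1]
      fin_cases j
      · simp; ring_nf; simp
      · simp only [Fin.mk_one, if_true]; linear_combination hδ

omit hk₀ hX in
lemma secondTypeDet_mem_maxIdeal : secondTypeDet e F ∈ maxIdeal a := by
  rw [mem_maxIdeal, eval_secondTypeDet hF,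
    Matrix.exists_mulVec_eq_zero_iff.mp ⟨c, hs.ne_zero, hs.mulVec_eq_zero⟩, mul_zero]

omit hk₀ in
/-- `M(X)` is smooth at a line of the second type which is not a triple line. -/
theorem exists_localBranches_one
    (hm : ∃ u, polar F (vec e a u) (complVec e c) (complVec e c) ≠ 0) :
    ∃ (Y : Fin 1 → Fin 2 × Fin 3 → ℂ) (l : Fin 2 × Fin 3 → ℂ),
      LocalBranches (curveIdeal e F) a Y ∧ ∑ i, l i * Y 0 i = 1 := by
  obtain ⟨k₀, hk₀⟩ := Function.ne_iff.mp hs.ne_zero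
  have hres := derivMatrix_resultant_ne_zero hF hs hk₀ hX
  obtain ⟨κ, hκ, htay⟩ := taylorForm_secondTypeDet_tangent hF hs hk₀
  set M := derivMatrix e F a
  set m₀ := polar F (vec e a 0) (complVec e c) (complVec e c) with hm₀
  set m₁ := polar F (vec e a 1) (complVec e c) (complVec e c) with hm₁
  set α := M 1 (k₀ + 1) * M 2 (k₀ + 2) - M 1 (k₀ + 2) * M 2 (k₀ + 1)
  set β := M 2 (k₀ + 1) * M 0 (k₀ + 2) - M 0 (k₀ + 1) * M 2 (k₀ + 2)
  set γ := M 0 (k₀ + 1) * M 1 (k₀ + 2) - M 0 (k₀ + 2) * M 1 (k₀ + 1)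
  -- These are the coefficients of `l 0` and `l 1` in the linear part of the determinant. They arise
  -- from `(m₀, m₁)` by the matrix with rows (2α, β) and (β, 2γ), which is invertible since its
  -- determinant is minus the discriminant.
  have hPQ : 2 * α * m₀ + β * m₁ ≠ 0 ∨ β * m₀ + 2 * γ * m₁ ≠ 0 := by
    by_contra hcon
    push Not at hcon
    obtain ⟨h1, h2⟩ := hcon
    have e0 : (β ^ 2 - 4 * α * γ) * m₀ = 0 := by linear_combination β * h2 - 2 * γ * h1
    have e1 : (β ^ 2 - 4 * α * γ) * m₁ = 0 := by linear_combination β * h1 - 2 * α * h2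
    have z0 := (mul_eq_zero.mp e0).resolve_left hres
    have z1 := (mul_eq_zero.mp e1).resolve_left hres
    obtain ⟨u, hu⟩ := hm
    fin_cases u
    exacts [hu z0, hu z1]
  obtain ⟨l, hl, hl0, hl1⟩ := exists_adapted_basis hPQ
  obtain ⟨s, μ, hsΛ, hdec, hμ⟩ := exists_splitting hF hs hk₀ hX hl
  refine ⟨![tangent c (l 0)], fun i => μ 0 (Pi.single i 1), ?_, ?_⟩
  · refine localBranches_of_linear (g := secondTypeDet e F) (Y := fun j => tangent c (l j))
      fanoEq_mem secondTypeDet_mem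
      (fun f hf x => eval_eq_zero_of_mem_curveIdeal hf) (fanoEq_mem_maxIdeal hF hs.fano)
      (Λ := fanoDiff F e a) (fun y i => rfl) hsΛ (fun j => fanoDiff_tangent hF hs (l j)) hdec
      (secondTypeDet_mem_maxIdeal hF hs) ?_ ?_
    · rw [(htay (l 0)).1]
      linear_combination κ * hl0
    · rw [(htay (l 1)).1]
      convert mul_ne_zero hκ hl1 using 2
      ring
  · rw [Matrix.cons_val_zero, ← functional_eq_sum, hμ, if_pos rfl]

omit hk₀ in
/-- `M(X)` has two transversal smooth branches at a triple line. -/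
theorem exists_localBranches_two
    (hm : ∀ u, polar F (vec e a u) (complVec e c) (complVec e c) = 0)
    (hn : polar F (complVec e c) (complVec e c) (complVec e c) ≠ 0) :
    ∃ Y : Fin 2 → Fin 2 × Fin 3 → ℂ, LocalBranches (curveIdeal e F) a Y ∧
      ∀ v : Fin 2 → ℂ, ∃ l : Fin 2 × Fin 3 → ℂ, ∀ j, ∑ i, l i * Y j i = v j := by
  obtain ⟨k₀, hk₀⟩ := Function.ne_iff.mp hs.ne_zero
  have hres := derivMatrix_resultant_ne_zero hF hs hk₀ hX
  obtain ⟨κ, hκ, htay⟩ := taylorForm_secondTypeDet_tangent hF hs hk₀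
  set n := complVec e c with hndef
  obtain ⟨l, hl, B, hB, hlB⟩ := exists_isotropic_basis hres
  obtain ⟨s, μ, hsΛ, hdec, hμ⟩ := exists_splitting hF hs hk₀ hX hl
  refine ⟨fun j => tangent c (l j), ?_, fun v => ?_⟩
  swap
  · refine ⟨fun i => (v 0 • μ 0 + v 1 • μ 1) (Pi.single i 1), fun j => ?_⟩
    rw [← functional_eq_sum, LinearMap.add_apply, LinearMap.smul_apply, LinearMap.smul_apply,
      hμ, hμ]
    fin_cases j <;> simp
  have hd1 : ∀ l', eval (tangent c l') (taylorForm a 1 (secondTypeDet e F)) = 0 := fun l' => by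
    rw [(htay l').1, hm, hm]; ring
  have hlin := taylorForm_isHomogeneous a 1 (secondTypeDet e F)
  -- The linear part of the determinant vanishes on the kernel of `fanoDiff`, so it is a combination
  -- of the Fano differentials. Subtracting that combination of equations leaves an element `g` of
  -- order two.
  let ξ : Fin 4 → ℂ := fun i => eval (s (Pi.single i 1)) (taylorForm a 1 (secondTypeDet e F))
  have hξ : ∀ y, eval y (taylorForm a 1 (secondTypeDet e F)) = ∑ i, ξ i * fanoDiff F e a y i := by
    intro y
    conv_lhs => rw [hdec y]
    rw [eval_add_of_isHomogeneous_one hlin, eval_add_of_isHomogeneous_one hlin,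
      eval_smul_of_isHomogeneous hlin, eval_smul_of_isHomogeneous hlin, hd1, hd1, mul_zero,
      mul_zero, add_zero, add_zero]
    let D : (Fin 4 → ℂ) →ₗ[ℂ] ℂ :=
      { toFun := fun z => eval (s z) (taylorForm a 1 (secondTypeDet e F))
        map_add' := fun z w => by rw [map_add, eval_add_of_isHomogeneous_one hlin]
        map_smul' := fun t z => by
          rw [map_smul, eval_smul_of_isHomogeneous hlin, pow_one]; rfl }
    exact functional_eq_sum D (fanoDiff F e a y)
  let g := secondTypeDet e F - ∑ i, C (ξ i) * fanoEq e F i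
  have hgI : g ∈ curveIdeal e F := Ideal.sub_mem _ secondTypeDet_mem
    (Ideal.sum_mem _ fun i _ => Ideal.mul_mem_left _ _ (fanoEq_mem i))
  have htC : ∀ (k : ℕ) (r : ℂ) (f : ChartRing) (y : Fin 2 × Fin 3 → ℂ),
      eval y (taylorForm a k (C r * f)) = r * eval y (taylorForm a k f) := by
    intro k r f y
    rw [← coeff_toLine, ← coeff_toLine, map_mul]
    have : toLine a y (C r) = Polynomial.C r := by simp [toLine]
    rw [this, Polynomial.coeff_C_mul]
  refine localBranches_of_quadratic (g := g) (Y := fun j => tangent c (l j)) fanoEq_mem hgI ?_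
    (fanoEq_mem_maxIdeal hF hs.fano) (Λ := fanoDiff F e a) (fun y i => rfl) hsΛ
    (fun j => fanoDiff_tangent hF hs (l j)) hdec ?_
    (B := (κ * polar F n n n) * B) ?_ ?_
  · intro f hf x hx hgx
    refine eval_eq_zero_of_mem_curveIdeal hf hx ?_
    simpa [g, hx] using hgx
  · rw [mem_maxIdeal_pow]
    intro k hk
    refine MvPolynomial.funext fun y => ?_
    interval_cases k
    · rw [taylorForm_zero, map_zero]
      exact Ideal.sub_mem (maxIdeal a) (secondTypeDet_mem_maxIdeal hF hs)
        (Ideal.sum_mem _ fun i _ => Ideal.mul_mem_left _ _ (fanoEq_mem_maxIdeal hF hs.fano i))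
    · rw [taylorForm_sub, taylorForm_sum, map_sub, map_sum, hξ, map_zero, sub_eq_zero]
      exact Finset.sum_congr rfl fun i _ => (htC _ _ _ _).symm
  · exact mul_ne_zero (mul_ne_zero hκ hn) hB
  · intro u v
    have htan : u • tangent c (l 0) + v • tangent c (l 1) = tangent c (u • l 0 + v • l 1) := by
      funext ⟨w, k⟩
      simp only [tangent, Pi.add_apply, Pi.smul_apply, smul_eq_mul]
      ring
    -- The subtracted Fano equations contribute nothing quadratic on the tangent plane, so `g` and
    -- the determinant have the same quadratic form there.
    have h2 := (taylorForm_fanoEq (e := e) (a := a) hF (tangent c (u • l 0 + v • l 1))).2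
      fun w w' w'' => by
        rw [complVec_tangent, complVec_tangent, map_smul, map_smul, LinearMap.smul_apply, hm,
          smul_zero, smul_zero]
    rw [htan, taylorForm_sub, taylorForm_sum, map_sub, map_sum, (htay _).2 hm]
    simp only [htC, h2, mul_zero, Finset.sum_const_zero, sub_zero, Pi.add_apply, Pi.smul_apply,
      smul_eq_mul]
    linear_combination (κ * polar F n n n) * hlB u v

end SpecialPoint

/-! ### Planes tangent along a line, and the covering by charts -/

section Planes

variable (e : Fin 2 ⊕ Fin 3 ≃ Fin 5) {F : MvPolynomial (Fin 5) ℂ} (a : Fin 2 × Fin 3 → ℂ)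

/-- The plane spanned by the line with coordinates `a` and the direction `c`. -/
def planeOf (c : Fin 3 → ℂ) : Submodule ℂ (Fin 5 → ℂ) :=
  Submodule.span ℂ (Set.range ![vec e a 0, vec e a 1, complVec e c])

variable {e a}

lemma vec_mem_chartLine (u : Fin 2) : vec e a u ∈ chartLine e a :=
  Submodule.subset_span ⟨u, rfl⟩

lemma mem_chartLine_iff {x : Fin 5 → ℂ} :
    x ∈ chartLine e a ↔ ∃ p q : ℂ, p • vec e a 0 + q • vec e a 1 = x := by
  rw [chartLine_eq_span, Submodule.mem_span_pair]

lemma mem_planeOf_iff {c : Fin 3 → ℂ} {x : Fin 5 → ℂ} : x ∈ planeOf e a c ↔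
    ∃ p q z : ℂ, p • vec e a 0 + q • vec e a 1 + z • complVec e c = x := by
  rw [planeOf, Submodule.mem_span_range_iff_exists_fun]
  constructor
  · rintro ⟨t, rfl⟩
    exact ⟨t 0, t 1, t 2, by simp [Fin.sum_univ_three]⟩
  · rintro ⟨p, q, z, rfl⟩
    exact ⟨![p, q, z], by simp [Fin.sum_univ_three]⟩

lemma finrank_chartLine : Module.finrank ℂ (chartLine e a) = 2 := by
  have h : LinearIndependent ℂ (vec e a) := by
    rw [Fintype.linearIndependent_iff]
    intro g hg u
    have := congrFun hg (e (Sum.inl u))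
    simpa [vec_inl] using this
  exact (finrank_span_eq_card h).trans (by simp)

lemma coords_combination (p q z : ℂ) (c : Fin 3 → ℂ) :
    (p • vec e a 0 + q • vec e a 1 + z • complVec e c) (e (Sum.inl 0)) = p ∧
    (p • vec e a 0 + q • vec e a 1 + z • complVec e c) (e (Sum.inl 1)) = q ∧
    ∀ k, (p • vec e a 0 + q • vec e a 1 + z • complVec e c) (e (Sum.inr k))
      = p * a (0, k) + q * a (1, k) + z * c k := by
  refine ⟨?_, ?_, fun k => ?_⟩
  · simp [vec_inl, complVec_inl]
  · simp [vec_inl, complVec_inl]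
  · simp [vec_inr, complVec_inr]

lemma finrank_planeOf {c : Fin 3 → ℂ} (hc : c ≠ 0) : Module.finrank ℂ (planeOf e a c) = 3 := by
  have h : LinearIndependent ℂ ![vec e a 0, vec e a 1, complVec e c] := by
    rw [Fintype.linearIndependent_iff]
    intro g hg
    obtain ⟨k, hk⟩ := Function.ne_iff.mp hc
    have hg' : g 0 • vec e a 0 + g 1 • vec e a 1 + g 2 • complVec e c = 0 := by
      simpa [Fin.sum_univ_three] using hg
    obtain ⟨h0, h1, h2⟩ := coords_combination (e := e) (a := a) (g 0) (g 1) (g 2) c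
    rw [hg'] at h0 h1 h2
    have h2 := h2 k
    have e0 : g 0 = 0 := h0.symm
    have e1 : g 1 = 0 := h1.symm
    rw [e0, e1, zero_mul, zero_mul, zero_add, zero_add] at h2
    have e2 : g 2 = 0 := (mul_eq_zero.mp h2.symm).resolve_right hk
    intro i
    fin_cases i
    exacts [e0, e1, e2]
  exact (finrank_span_eq_card h).trans (by simp)

lemma polar_combination (x n : Fin 5 → ℂ) (z : ℂ) :
    polar F (x + z • n) (x + z • n) (x + z • n)
      = polar F x x x + 3 * z * polar F x x n + 3 * z ^ 2 * polar F x n n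
        + z ^ 3 * polar F n n n := by
  simp only [map_add, LinearMap.add_apply, map_smul, LinearMap.smul_apply, smul_eq_mul]
  rw [polar_rotate n x x, polar_swap_right x n x, polar_swap n x n, polar_rotate n n x,
    polar_swap n x n]
  ring

/-- A smooth cubic threefold contains no plane. -/
lemma plane_not_subset (hF : F.IsHomogeneous 3) (hX : IsSmooth F) {c : Fin 3 → ℂ}
    (hs : IsSpecial e F a c) (hm : ∀ u, polar F (vec e a u) (complVec e c) (complVec e c) = 0) :
    polar F (complVec e c) (complVec e c) (complVec e c) ≠ 0 := by
  intro hn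
  obtain ⟨k₀, hk₀⟩ := Function.ne_iff.mp hs.ne_zero
  have hk₀ : c k₀ ≠ 0 := hk₀
  have hker := polar_vec_vec_complVec_eq_zero hs.mulVec_eq_zero
  let S : Fin 3 → Matrix (Fin 3) (Fin 3) ℂ := fun k => Matrix.of fun i j =>
    polar F (![vec e a 0, vec e a 1, complVec e c] i) (![vec e a 0, vec e a 1, complVec e c] j)
      (Pi.single (e (Sum.inr k)) 1)
  have hS : ∀ k, (S k).IsSymm := fun k => by
    ext i j
    exact polar_swap _ _ _
  -- If the plane lay on the cubic, two of the transverse derivatives would restrict to conics on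
  -- it, and these meet.
  obtain ⟨z, hz, h1, h2⟩ := exists_common_zero (S (k₀ + 1)) (S (k₀ + 2)) (hS _) (hS _)
  set n := complVec e c with hndef
  let x := z 0 • vec e a 0 + z 1 • vec e a 1 + z 2 • n
  have hSx : ∀ k, z ⬝ᵥ (S k).mulVec z = polar F x x (Pi.single (e (Sum.inr k)) 1) := by
    intro k
    simp only [x, map_add, LinearMap.add_apply, map_smul, LinearMap.smul_apply, smul_eq_mul]
    simp [S, Matrix.mulVec, dotProduct, Fin.sum_univ_three]
    ring
  rw [hSx] at h1 h2
  have hx : x ≠ 0 := by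
    intro hx0
    obtain ⟨g0, g1, g2⟩ := coords_combination (e := e) (a := a) (z 0) (z 1) (z 2) c
    change x _ = _ at g0
    change x _ = _ at g1
    have g2 := g2 k₀
    change x _ = _ at g2
    rw [hx0] at g0 g1 g2
    rw [← g0, ← g1] at g2
    apply hz
    have z2 : z 2 = 0 := by simpa [hk₀] using g2.symm
    funext i
    fin_cases i
    exacts [g0.symm, g1.symm, z2]
  have hxy : ∀ y, (∀ u v, polar F (vec e a u) (vec e a v) y = 0) →
      (∀ u, polar F (vec e a u) n y = 0) → polar F n n y = 0 → polar F x x y = 0 := by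
    intro y hy1 hy2 hy3
    have hy4 : ∀ u, polar F n (vec e a u) y = 0 := fun u => by rw [polar_swap, hy2]
    simp only [x, map_add, LinearMap.add_apply, map_smul, LinearMap.smul_apply, smul_eq_mul,
      hy1, hy2, hy3, hy4, mul_zero, add_zero]
  have hxn : polar F x x n = 0 := hxy n hker hm hn
  refine polar_singular_false (e := e) (a := a) hF hX hx (fun u => ?_) fun k => ?_
  · refine hxy _ (fun _ _ => hs.fano _ _ _) (fun v => ?_) ?_
    · rw [polar_swap_right, hker]
    · rw [← polar_rotate, hm]
  -- The derivative along `n` vanishes because the plane lies on the cubic. As `c k₀ ≠ 0`, this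
  -- forces the third transverse derivative to vanish as well, giving a singular point.
  · have hsum := polar_complVec (F := F) (e := e) x x c
    rw [← hndef, hxn, sum_fin_three_rotate _ k₀, h1, h2, zero_mul, zero_mul, add_zero,
      add_zero] at hsum
    have h0 := (mul_eq_zero.mp hsum.symm).resolve_right hk₀
    have hk : k = k₀ ∨ k = k₀ + 1 ∨ k = k₀ + 2 := by
      clear * -
      revert k k₀; decide
    rcases hk with rfl | rfl | rfl
    exacts [h0, h1, h2]

/-- A plane tangent to the cubic along a line gives a special direction. -/
lemma exists_isSpecial_of_planeSection (hF : F.IsHomogeneous 3)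
    {P L' : Submodule ℂ (Fin 5 → ℂ)} (h : PlaneSection F P (chartLine e a) L') :
    ∃ c, IsSpecial e F a c ∧ P = planeOf e a c ∧ (L' = chartLine e a →
      ∀ u, polar F (vec e a u) (complVec e c) (complVec e c) = 0) := by
  obtain ⟨hP, hL, -, l, m, hl, hm, hF'⟩ := h
  have hLP : chartLine e a ≤ P := by rw [← hl]; exact inf_le_left
  have hlv : ∀ u, l (vec e a u) = 0 := fun u => by
    have : vec e a u ∈ P ⊓ LinearMap.ker l := by rw [hl]; exact vec_mem_chartLine u
    exact this.2
  obtain ⟨w, hwP, hwL⟩ : ∃ w ∈ P, w ∉ chartLine e a := by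
    refine SetLike.exists_of_lt (lt_of_le_of_ne hLP ?_)
    intro heq
    rw [← heq, hL] at hP
    omega
  let c : Fin 3 → ℂ := fun k => w (e (Sum.inr k)) - w (e (Sum.inl 0)) * a (0, k)
        - w (e (Sum.inl 1)) * a (1, k)
  have hw : w = w (e (Sum.inl 0)) • vec e a 0 + w (e (Sum.inl 1)) • vec e a 1 + complVec e c :=
    eq_vec_add_complVec e a w
  set n := complVec e c with hndef
  have hline : ∀ p q : ℂ, p • vec e a 0 + q • vec e a 1 ∈ chartLine e a := fun p q =>
    mem_chartLine_iff.mpr ⟨p, q, rfl⟩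
  have hnP : n ∈ P := by
    have : n = w - (w (e (Sum.inl 0)) • vec e a 0 + w (e (Sum.inl 1)) • vec e a 1) :=
      eq_sub_of_add_eq' hw.symm
    rw [this]
    exact P.sub_mem hwP (hLP (hline _ _))
  have hnL : n ∉ chartLine e a := fun hn => hwL (by
    rw [hw]; exact Submodule.add_mem _ (hline _ _) hn)
  have key : ∀ p q : ℂ, polar F (p • vec e a 0 + q • vec e a 1) (p • vec e a 0 + q • vec e a 1)
      (p • vec e a 0 + q • vec e a 1) = 0 ∧
      polar F (p • vec e a 0 + q • vec e a 1) (p • vec e a 0 + q • vec e a 1) n = 0 ∧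
      3 * polar F (p • vec e a 0 + q • vec e a 1) n n
        = l n ^ 2 * m (p • vec e a 0 + q • vec e a 1) := by
    intro p q
    have hx := hline p q
    have hlx : l (p • vec e a 0 + q • vec e a 1) = 0 := by simp [hlv]
    set x := p • vec e a 0 + q • vec e a 1
    have hz : ∀ z : ℂ, polar F x x x + 3 * z * polar F x x n + 3 * z ^ 2 * polar F x n n
        + z ^ 3 * polar F n n n = z ^ 2 * l n ^ 2 * (m x + z * m n) := by
      intro z
      have := hF' (x + z • n) (P.add_mem (hLP hx) (P.smul_mem z hnP))
      rw [eval_eq_polar hF, polar_combination, map_add l, map_add m, map_smul l, map_smul m,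
        hlx] at this
      rw [this]
      simp only [smul_eq_mul]
      ring
    -- Four values of `z` suffice to separate the coefficients of a cubic polynomial identity.
    have z0 := hz 0
    have z1 := hz 1
    have z2 := hz (-1)
    have z3 := hz 2
    refine ⟨by linear_combination z0, ?_, ?_⟩
    · linear_combination -z0 / 6 + z1 / 3 - z2 / 9 - z3 / 18
    · linear_combination -z0 + z1 / 2 + z2 / 2
  have hkey1 := fun p q => (key p q).1
  have hkey2 := fun p q => (key p q).2.1
  simp only [map_add, LinearMap.add_apply, map_smul, LinearMap.smul_apply, smul_eq_mul,
    polar_swap (vec e a 1) (vec e a 0) _] at hkey2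
  have hker : ∀ i j, polar F (vec e a i) (vec e a j) n = 0 := by
    have q0 := hkey2 1 0
    have q1 := hkey2 0 1
    have q2 := hkey2 1 1
    have e1 : polar F (vec e a 0) (vec e a 1) n = 0 := by linear_combination (q2 - q0 - q1) / 2
    have e0 : polar F (vec e a 0) (vec e a 0) n = 0 := by linear_combination q0
    have e2 : polar F (vec e a 1) (vec e a 1) n = 0 := by linear_combination q1
    intro i j
    fin_cases i <;> fin_cases j
    · exact e0
    · exact e1
    · exact (polar_swap _ _ _).trans e1
    · exact e2
  refine ⟨c, ⟨?_, ?_, ?_⟩, ?_, ?_⟩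
  · intro hc
    apply hnL
    rw [hndef, hc, map_zero]
    exact Submodule.zero_mem _
  · have f : ∀ p q : ℂ, p ^ 3 * polar F (vec e a 0) (vec e a 0) (vec e a 0)
        + 3 * p ^ 2 * q * polar F (vec e a 0) (vec e a 0) (vec e a 1)
        + 3 * p * q ^ 2 * polar F (vec e a 0) (vec e a 1) (vec e a 1)
        + q ^ 3 * polar F (vec e a 1) (vec e a 1) (vec e a 1) = 0 := by
      intro p q
      have := hkey1 p q
      rw [polar_combination] at this
      simp only [map_smul, LinearMap.smul_apply, smul_eq_mul] at this
      linear_combination this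
    have f0 := f 1 0
    have f1 := f 0 1
    have f2 := f 1 1
    have f3 := f 1 (-1)
    have t0 : polar F (vec e a 0) (vec e a 0) (vec e a 0) = 0 := by linear_combination f0
    have t1 : polar F (vec e a 0) (vec e a 0) (vec e a 1) = 0 := by
      linear_combination (f2 - f3) / 6 - f1 / 3
    have t2 : polar F (vec e a 0) (vec e a 1) (vec e a 1) = 0 := by
      linear_combination (f2 + f3) / 6 - f0 / 3
    have t3 : polar F (vec e a 1) (vec e a 1) (vec e a 1) = 0 := by linear_combination f1
    intro i j k
    fin_cases i <;> fin_cases j <;> fin_cases k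
    · exact t0
    · exact t1
    · exact (polar_swap_right _ _ _).trans t1
    · exact t2
    · exact (polar_rotate _ _ _).trans t1
    · exact (polar_swap _ _ _).trans t2
    · exact (polar_rotate _ _ _).trans ((polar_swap _ _ _).trans t2)
    · exact t3
  · rw [derivMatrix_mulVec]
    simp only [← hndef, hker]
    ext i; fin_cases i <;> rfl
  · symm
    refine Submodule.eq_of_le_of_finrank_eq ?_ ?_
    · rintro x hx
      obtain ⟨p, q, z, rfl⟩ := mem_planeOf_iff.mp hx
      exact P.add_mem (hLP (hline p q)) (P.smul_mem z hnP)
    · rw [hP]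
      refine finrank_planeOf fun hc => hnL ?_
      rw [hndef, hc, map_zero]
      exact Submodule.zero_mem _
  · intro hL'
    have hmv : ∀ u, m (vec e a u) = 0 := fun u => by
      have : vec e a u ∈ P ⊓ LinearMap.ker m := by rw [hm, hL']; exact vec_mem_chartLine u
      exact this.2
    have hmn : ∀ p q : ℂ, polar F (p • vec e a 0 + q • vec e a 1) n n = 0 := by
      intro p q
      have hm0 : m (p • vec e a 0 + q • vec e a 1) = 0 := by
        rw [map_add, map_smul, map_smul, hmv, hmv, smul_zero, smul_zero, add_zero]
      have := (key p q).2.2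
      rw [hm0, mul_zero] at this
      exact (mul_eq_zero.mp this).resolve_left (by norm_num)
    have hx0 : (1 : ℂ) • vec e a 0 + (0 : ℂ) • vec e a 1 = vec e a 0 := by simp
    have hx1 : (0 : ℂ) • vec e a 0 + (1 : ℂ) • vec e a 1 = vec e a 1 := by simp
    have m0 : polar F (vec e a 0) n n = 0 := (congrArg (fun x => polar F x n n) hx0).symm.trans (hmn 1 0)
    have m1 : polar F (vec e a 1) n n = 0 := (congrArg (fun x => polar F x n n) hx1).symm.trans (hmn 0 1)
    rw [← hndef]
    exact Fin.forall_fin_two.mpr ⟨m0, m1⟩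

/-- The special direction at a point of the curve is unique up to a scalar. -/
lemma planeOf_eq_of_isSpecial (hF : F.IsHomogeneous 3) (hX : IsSmooth F) {c c' : Fin 3 → ℂ}
    (hs : IsSpecial e F a c) (hs' : IsSpecial e F a c') : planeOf e a c = planeOf e a c' := by
  symm
  refine Submodule.eq_of_le_of_finrank_eq ?_ ?_
  · obtain ⟨k₀, hk₀⟩ := Function.ne_iff.mp hs.ne_zero
    -- A second special direction `c'` also gives tangent vectors of the Fano surface, and all of
    -- these have the shape `tangent c _`.
    have h1 := eq_tangent_of_fanoDiff_eq_zero hF hs hk₀ hX (fanoDiff_tangent hF hs' ![1, 0])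
    have h2 : c' = (c' k₀ / c k₀) • c := by
      funext k
      have := congrFun h1 (0, k)
      simpa [tangent] using this
    intro x hx
    obtain ⟨p, q, z, rfl⟩ := mem_planeOf_iff.mp hx
    refine mem_planeOf_iff.mpr ⟨p, q, z * (c' k₀ / c k₀), ?_⟩
    rw [h2, map_smul, smul_smul, ← h2]
  · rw [finrank_planeOf hs.ne_zero, finrank_planeOf hs'.ne_zero]

lemma finrank_inf_ker {P : Submodule ℂ (Fin 5 → ℂ)} {n : ℕ} (hP : Module.finrank ℂ P = n + 1)
    {m : Module.Dual ℂ (Fin 5 → ℂ)} {x : Fin 5 → ℂ} (hx : x ∈ P) (hmx : m x ≠ 0) :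
    Module.finrank ℂ (P ⊓ LinearMap.ker m : Submodule ℂ (Fin 5 → ℂ)) = n := by
  let m' : Module.Dual ℂ P := m.comp P.subtype
  have hm' : m' ≠ 0 := fun h => hmx (congrArg (fun f : Module.Dual ℂ P => f ⟨x, hx⟩) h)
  have h1 := Module.Dual.finrank_ker_add_one_of_ne_zero hm'
  have h2 : (LinearMap.ker m').map P.subtype = P ⊓ LinearMap.ker m := by
    rw [LinearMap.ker_comp, Submodule.map_comap_subtype]
  rw [← h2, Submodule.finrank_map_subtype_eq]
  omega

/-- The plane section given by a special direction. -/
lemma planeSection_of_isSpecial (hF : F.IsHomogeneous 3) (hX : IsSmooth F) {c : Fin 3 → ℂ}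
    (hs : IsSpecial e F a c) :
    (∃ L', PlaneSection F (planeOf e a c) (chartLine e a) L') ∧
    ((∀ u, polar F (vec e a u) (complVec e c) (complVec e c) = 0) →
      PlaneSection F (planeOf e a c) (chartLine e a) (chartLine e a)) := by
  obtain ⟨k₀, hk₀⟩ := Function.ne_iff.mp hs.ne_zero
  have hk₀ : c k₀ ≠ 0 := hk₀
  have hker := polar_vec_vec_complVec_eq_zero hs.mulVec_eq_zero
  let pr : Fin 5 → Module.Dual ℂ (Fin 5 → ℂ) := fun i => LinearMap.proj i
  let ζ : Module.Dual ℂ (Fin 5 → ℂ) := (c k₀)⁻¹ • (pr (e (Sum.inr k₀))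
    - a (0, k₀) • pr (e (Sum.inl 0)) - a (1, k₀) • pr (e (Sum.inl 1)))
  set n := complVec e c with hndef
  -- On the plane `ζ` is the coordinate along `n`, and `m` is the cofactor left after dividing `F`
  -- by `ζ ^ 2`.
  let m : Module.Dual ℂ (Fin 5 → ℂ) := (3 * polar F (vec e a 0) n n) • pr (e (Sum.inl 0))
    + (3 * polar F (vec e a 1) n n) • pr (e (Sum.inl 1)) + polar F n n n • ζ
  have hζ : ∀ p q z : ℂ, ζ (p • vec e a 0 + q • vec e a 1 + z • n) = z := by
    intro p q z
    obtain ⟨h0, h1, h2⟩ := coords_combination (e := e) (a := a) p q z c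
    have : ∀ x, ζ x = (c k₀)⁻¹ * (x (e (Sum.inr k₀)) - a (0, k₀) * x (e (Sum.inl 0))
        - a (1, k₀) * x (e (Sum.inl 1))) := fun x => rfl
    rw [this, h0, h1, h2]
    field_simp
    ring
  have hmx : ∀ p q z : ℂ, m (p • vec e a 0 + q • vec e a 1 + z • n)
      = 3 * polar F (vec e a 0) n n * p + 3 * polar F (vec e a 1) n n * q
        + polar F n n n * z := by
    intro p q z
    obtain ⟨h0, h1, -⟩ := coords_combination (e := e) (a := a) p q z c
    have : ∀ x, m x = 3 * polar F (vec e a 0) n n * x (e (Sum.inl 0))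
      + 3 * polar F (vec e a 1) n n * x (e (Sum.inl 1)) + polar F n n n * ζ x := fun x => rfl
    rw [this, h0, h1, hζ]
  have hFx : ∀ x ∈ planeOf e a c, eval x F = ζ x ^ 2 * m x := by
    intro x hx
    obtain ⟨p, q, z, rfl⟩ := mem_planeOf_iff.mp hx
    change eval (p • vec e a 0 + q • vec e a 1 + z • n) F
      = ζ (p • vec e a 0 + q • vec e a 1 + z • n) ^ 2 * m (p • vec e a 0 + q • vec e a 1 + z • n)
    rw [hζ, hmx, eval_eq_polar hF, polar_combination]
    simp only [map_add, LinearMap.add_apply, map_smul, LinearMap.smul_apply, smul_eq_mul, hs.fano,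
      hker]
    ring
  have hL : planeOf e a c ⊓ LinearMap.ker ζ = chartLine e a := by
    ext x
    rw [Submodule.mem_inf, LinearMap.mem_ker, mem_chartLine_iff, mem_planeOf_iff]
    constructor
    · rintro ⟨⟨p, q, z, rfl⟩, h⟩
      rw [hζ] at h
      exact ⟨p, q, by rw [h, zero_smul, add_zero]⟩
    · rintro ⟨p, q, rfl⟩
      have h := hζ p q 0
      rw [zero_smul, add_zero] at h
      exact ⟨⟨p, q, 0, by rw [zero_smul, add_zero]⟩, h⟩
  have hP := finrank_planeOf (e := e) (a := a) hs.ne_zero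
  refine ⟨⟨planeOf e a c ⊓ LinearMap.ker m, hP, finrank_chartLine, ?_, ζ, m, hL, rfl, hFx⟩,
    fun hm => ⟨hP, finrank_chartLine, finrank_chartLine, ζ, m, hL, ?_, hFx⟩⟩
  · obtain ⟨p, q, z, hne⟩ : ∃ p q z, m (p • vec e a 0 + q • vec e a 1 + z • n) ≠ 0 := by
      refine Classical.byContradiction fun hcon => ?_
      push Not at hcon
      replace hcon : ∀ p q z : ℂ, 3 * polar F (vec e a 0) n n * p
          + 3 * polar F (vec e a 1) n n * q + polar F n n n * z = 0 :=
        fun p q z => (hmx p q z).symm.trans (hcon p q z)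
      have h0 : polar F (vec e a 0) n n = 0 := by linear_combination hcon 1 0 0 / 3
      have h1 : polar F (vec e a 1) n n = 0 := by linear_combination hcon 0 1 0 / 3
      refine plane_not_subset hF hX hs (fun u => ?_) (by linear_combination hcon 0 0 1)
      fin_cases u
      exacts [h0, h1]
    exact finrank_inf_ker hP (mem_planeOf_iff.mpr ⟨p, q, z, rfl⟩) hne
  · rw [← hL]
    ext x
    rw [Submodule.mem_inf, Submodule.mem_inf, LinearMap.mem_ker, LinearMap.mem_ker]
    refine and_congr_right fun hx => ?_
    obtain ⟨p, q, z, rfl⟩ := mem_planeOf_iff.mp hx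
    change m (p • vec e a 0 + q • vec e a 1 + z • n) = 0
      ↔ ζ (p • vec e a 0 + q • vec e a 1 + z • n) = 0
    -- At a triple line `m` restricts to the nonzero multiple `polar F n n n` of `ζ`, so both forms
    -- cut out the same line.
    have hN : polar F n n n ≠ 0 := plane_not_subset hF hX hs hm
    rw [hmx, hζ, hm, hm]
    simp [hN]

theorem memCurve_iff_isSecondType (hF : F.IsHomogeneous 3) (hX : IsSmooth F) :
    MemCurve e F a ↔ IsSecondType F (chartLine e a) := by
  rw [memCurve_iff_exists hF]
  constructor
  · rintro ⟨c, hs⟩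
    refine ⟨planeOf e a c, (planeSection_of_isSpecial hF hX hs).1, ?_⟩
    rintro P ⟨L', h⟩
    obtain ⟨c', hs', rfl, -⟩ := exists_isSpecial_of_planeSection hF h
    exact planeOf_eq_of_isSpecial hF hX hs' hs
  · rintro ⟨P, ⟨L', h⟩, -⟩
    obtain ⟨c, hs, -⟩ := exists_isSpecial_of_planeSection hF h
    exact ⟨c, hs⟩

theorem isTripleLine_iff (hF : F.IsHomogeneous 3) (hX : IsSmooth F) :
    IsTripleLine F (chartLine e a) ↔ ∃ c, IsSpecial e F a c ∧
      ∀ u, polar F (vec e a u) (complVec e c) (complVec e c) = 0 := by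
  constructor
  · rintro ⟨P, h⟩
    obtain ⟨c, hs, -, hm⟩ := exists_isSpecial_of_planeSection hF h
    exact ⟨c, hs, hm rfl⟩
  · rintro ⟨c, hs, hm⟩
    exact ⟨_, (planeSection_of_isSpecial hF hX hs).2 hm⟩

lemma exists_equiv_inl {i j : Fin 5} (hij : i ≠ j) :
    ∃ e : Fin 2 ⊕ Fin 3 ≃ Fin 5, e (Sum.inl 0) = i ∧ e (Sum.inl 1) = j := by
  let e₁ : Fin 2 ⊕ Fin 3 ≃ Fin 5 := finSumFinEquiv
  let e₂ := e₁.trans (Equiv.swap (e₁ (Sum.inl 0)) i)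
  have h2 : e₂ (Sum.inl 0) = i := by simp [e₂]
  refine ⟨e₂.trans (Equiv.swap (e₂ (Sum.inl 1)) j), ?_, by simp⟩
  rw [Equiv.trans_apply, h2]
  refine Equiv.swap_apply_of_ne_of_ne ?_ hij
  rw [← h2]
  exact fun h => by simpa using e₂.injective h

/-- The charts cover the Grassmannian of lines. -/
theorem exists_chartLine_eq {L : Submodule ℂ (Fin 5 → ℂ)} (hL : Module.finrank ℂ L = 2) :
    ∃ e a, chartLine e a = L := by
  obtain ⟨x, hxL, hx⟩ : ∃ x ∈ L, x ≠ 0 := by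
    refine Submodule.exists_mem_ne_zero_of_ne_bot ?_
    rintro rfl
    simp at hL
  obtain ⟨i, hi⟩ := Function.ne_iff.mp hx
  have hi : x i ≠ 0 := hi
  obtain ⟨y, hyL, hy⟩ : ∃ y ∈ L, y ∉ Submodule.span ℂ {x} := by
    refine SetLike.exists_of_lt (lt_of_le_of_ne ?_ ?_)
    · rwa [Submodule.span_singleton_le_iff_mem]
    · intro h
      rw [← h, finrank_span_singleton hx] at hL
      omega
  -- Row reduction of the basis `x`, `y`, with pivots in columns `i` and `j`.
  let y' := y - (y i / x i) • x
  have hy'L : y' ∈ L := L.sub_mem hyL (L.smul_mem _ hxL)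
  have hy'i : y' i = 0 := by
    simp only [y', Pi.sub_apply, Pi.smul_apply, smul_eq_mul]
    field_simp
    ring
  have hy'0 : y' ≠ 0 := fun h => hy (Submodule.mem_span_singleton.mpr ⟨_, (sub_eq_zero.mp h).symm⟩)
  obtain ⟨j, hj⟩ := Function.ne_iff.mp hy'0
  have hj : y' j ≠ 0 := hj
  have hij : i ≠ j := by rintro rfl; exact hj hy'i
  obtain ⟨e, he0, he1⟩ := exists_equiv_inl hij
  let v₁ := (y' j)⁻¹ • y'
  let v₀ := (x i)⁻¹ • x - (x j / x i) • v₁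
  have hv₁L : v₁ ∈ L := L.smul_mem _ hy'L
  have hv₀L : v₀ ∈ L := L.sub_mem (L.smul_mem _ hxL) (L.smul_mem _ hv₁L)
  have h1i : v₁ i = 0 := by simp [v₁, hy'i]
  have h1j : v₁ j = 1 := by simp [v₁, hj]
  have h0i : v₀ i = 1 := by
    simp only [v₀, Pi.sub_apply, Pi.smul_apply, smul_eq_mul, h1i]
    field_simp
    ring
  have h0j : v₀ j = 0 := by
    simp only [v₀, Pi.sub_apply, Pi.smul_apply, smul_eq_mul, h1j]
    field_simp
    ring
  let a : Fin 2 × Fin 3 → ℂ := fun p => (![v₀, v₁] p.1) (e (Sum.inr p.2))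
  have e0 : vec e a 0 = v₀ := by
    refine ext_chart e (fun u => ?_) fun k => by rw [vec_inr]; rfl
    rw [vec_inl]
    fin_cases u
    · simp [he0, h0i]
    · simp [he1, h0j]
  have e1 : vec e a 1 = v₁ := by
    refine ext_chart e (fun u => ?_) fun k => by rw [vec_inr]; rfl
    rw [vec_inl]
    fin_cases u
    · simp [he0, h1i]
    · simp [he1, h1j]
  refine ⟨e, a, Submodule.eq_of_le_of_finrank_eq ?_ (by rw [finrank_chartLine, hL])⟩
  intro w hw
  obtain ⟨p, q, rfl⟩ := mem_chartLine_iff.mp hw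
  rw [e0, e1]
  exact L.add_mem (L.smul_mem _ hv₀L) (L.smul_mem _ hv₁L)

end Planes

/-! ### Assembling the three assertions -/

section Main

variable {e : Fin 2 ⊕ Fin 3 ≃ Fin 5} {F : MvPolynomial (Fin 5) ℂ} {a : Fin 2 × Fin 3 → ℂ}

lemma comap_pointIdeal (h : MemCurve e F a) :
    (pointIdeal h).comap (Ideal.Quotient.mk (curveIdeal e F)) = maxIdeal a := by
  ext f
  exact Iff.rfl

theorem isRadical_curveIdeal (hF : F.IsHomogeneous 3) (hX : IsSmooth F) :
    (curveIdeal e F).IsRadical := by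
  refine isRadical_of_localBranches fun a ha => ?_
  obtain ⟨c, hs⟩ := (memCurve_iff_exists hF).mp ha
  by_cases hm : ∀ u, polar F (vec e a u) (complVec e c) (complVec e c) = 0
  · obtain ⟨Y, hY, -⟩ := exists_localBranches_two hF hs hX hm (plane_not_subset hF hX hs hm)
    exact ⟨2, Y, hY⟩
  · push Not at hm
    obtain ⟨Y, l, hY, -⟩ := exists_localBranches_one hF hs hX hm
    exact ⟨1, Y, hY⟩

theorem isRegularLocalRing_iff_not_isTripleLine (hF : F.IsHomogeneous 3) (hX : IsSmooth F)
    (h : MemCurve e F a) : IsRegularLocalRing (Localization.AtPrime (pointIdeal h)) ↔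
      ¬ IsTripleLine F (chartLine e a) := by
  rw [isTripleLine_iff hF hX]
  constructor
  · rintro hreg ⟨c, hs, hm⟩
    obtain ⟨Y, hY, hl⟩ := exists_localBranches_two hF hs hX hm (plane_not_subset hF hX hs hm)
    exact not_isRegularLocalRing_of_localBranches (comap_pointIdeal h) hY hl hreg
  · intro hn
    obtain ⟨c, hs⟩ := (memCurve_iff_exists hF).mp h
    obtain ⟨Y, l, hY, hl⟩ := exists_localBranches_one hF hs hX (by
      by_contra hcon
      push Not at hcon
      exact hn ⟨c, hs, hcon⟩)
    exact isRegularLocalRing_of_localBranches (comap_pointIdeal h) hY hl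

/-- Regularity was characterized in every chart by a condition on the line alone, so the choice of
chart in the definition of a singular point is immaterial; for a triple line any chart containing it
will do. -/
theorem isSingularPoint_iff (hF : F.IsHomogeneous 3) (hX : IsSmooth F)
    (L : Submodule ℂ (Fin 5 → ℂ)) : IsSingularPoint F L ↔ IsTripleLine F L := by
  constructor
  · rintro ⟨e, a, h, rfl, hreg⟩
    rwa [isRegularLocalRing_iff_not_isTripleLine hF hX h, not_not] at hreg
  · intro hL
    obtain ⟨P, hP⟩ := id hL
    obtain ⟨e, a, rfl⟩ := exists_chartLine_eq hP.2.1
    obtain ⟨c, hs, -⟩ := (isTripleLine_iff hF hX).mp hL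
    have h := (memCurve_iff_exists hF).mpr ⟨c, hs⟩
    refine ⟨e, a, h, rfl, ?_⟩
    rwa [isRegularLocalRing_iff_not_isTripleLine hF hX h, not_not]

end Main

end CubicThreefold
end

theorem theorem1 (F : MvPolynomial (Fin 5) ℂ) (hF : F.IsHomogeneous 3)
    (hX : CubicThreefold.IsSmooth F) :
    -- the closed points of the curve `M(X)` are the lines of the second type
    (∀ (e : Fin 2 ⊕ Fin 3 ≃ Fin 5) (a : Fin 2 × Fin 3 → ℂ),
      CubicThreefold.MemCurve e F a ↔
        CubicThreefold.IsSecondType F (CubicThreefold.chartLine e a)) ∧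
    -- the singular points of `M(X)` are exactly the triple lines
    (∀ L : Submodule ℂ (Fin 5 → ℂ),
      CubicThreefold.IsSingularPoint F L ↔ CubicThreefold.IsTripleLine F L) ∧
    -- `M(X)` is reduced
    (∀ e : Fin 2 ⊕ Fin 3 ≃ Fin 5, IsReduced (CubicThreefold.CurveRing e F)) :=
  ⟨fun _ _ => CubicThreefold.memCurve_iff_isSecondType hF hX,
    CubicThreefold.isSingularPoint_iff hF hX,
    fun _ => (Ideal.isRadical_iff_quotient_reduced _).mp
      (CubicThreefold.isRadical_curveIdeal hF hX)⟩
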